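/- For each $n$ consider a network of $n$ transmitter–receiver links whose channel coefficients $g_{ji}$, $1\le i,j\le n$ (from transmitter $j$ to receiver $i$), are i.i.d. exponential random variables with mean $1$. Let $\rho>0$ be the transmit SNR. For a set $\mathcal A$ of active links put $I_i=\sum_{j\in\mathcal A,\,j\ne i}g_{ji}$ and define the throughput $$T(\mathcal A)=\sum_{i\in\mathcal A}\log\Bigl(1+\frac{g_{ii}}{1/\rho+I_i}\Bigr).$$ DTBLAS with thresholds $\Delta,\delta$ works as follows. First, $\mathcal A_1=\{i: g_{ii}>\Delta\}$. Second, $\mathcal A=\mathcal A_2$ is a largest subset of $\mathcal A_1$ such that $g_{ij}\le\delta$ and $g_{ji}\le\delta$ for all $i\neq j$ in $\mathcal A_2$, that is, a largest complete subgraph of the graph $G$ on $\mathcal A_1$ in which $i\ne j$ are adjacent iff $g_{ij}\le\delta$ and $g_{ji}\le\delta$; if there are several largest ones, one of them is picked by an arbitrary rule that depends only on $n$, $\mathcal A_1$ and $G$. Write $k_2=|\mathcal A_2|$. Fix a required rate $\lambda=\log(1+\gamma_0)>0$ and an interference level $\beta>0$. The noise-limited regime is DTBLAS with $\Delta=\Delta_0=\gamma_0(1/\rho+\beta)$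 and with a deterministic threshold $\delta=\delta_n$ chosen such that $(k_2-1)\hat\mu=\beta$ holds asymptotically, i.e. $(k_2-1)\hat\mu_n\to\beta$ in probability, where $\hat\mu_n=\mathrm E(X\mid X\le\delta_n)$ for an exponential variable $X$ with mean $1$; or given by the asymptotic solution $\delta_n=\frac{2\beta\log\log n}{\log n}(1+o(1))$ of this equation. Let $T_{NL}$ be the throughput $T(\mathcal A)$ that DTBLAS achieves in this regime (under either choice of $\delta_n$). Then, asymptotically almost surely, the limit of $\frac{\log\log n}{\log n}T_{NL}$ exists and $$\log\Bigl(1+\frac{\Delta_0}{1/\rho+\beta}\Bigr)\le\lim_{n\to\infty}\frac{\log\log n}{\log n}\,T_{NL}\le\log\Bigl(1+\frac{\Delta_0+1}{1/\rho+\beta}\Bigr).$$ That is, there is a constant $L$ between the two bounds such that for every $\varepsilon>0$ the probability of $\bigl|\frac{\log\log n}{\log n}T_{NL}-L\bigr|<\varepsilon$ tends to $1$ as $n\to\infty$. -/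

import Mathlib

open MeasureTheory ProbabilityTheory Filter Topology

noncomputable section

namespace NoiseLimited

/-! Channel coefficients of an `n`-link network are written `g : Fin n → Fin n → ℝ`, where `g j i`
is the coefficient from transmitter `j` to receiver `i`. -/

/-- Interference `I_i` at receiver `i` when the links in `A` are active. -/
def interference {n : ℕ} (g : Fin n → Fin n → ℝ) (A : Finset (Fin n)) (i : Fin n) : ℝ :=
  ∑ j ∈ A.erase i, g j i

/-- Signal-to-interference-plus-noise ratio of link `i` at transmit SNR `ρ`. -/
def sinr {n : ℕ} (ρ : ℝ) (g : Fin n → Fin n → ℝ) (A : Finset (Fin n)) (i : Fin n) : ℝ :=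
  g i i / (1 / ρ + interference g A i)

/-- Maximum supportable rate of link `i`, in nats per channel use. -/
def rate {n : ℕ} (ρ : ℝ) (g : Fin n → Fin n → ℝ) (A : Finset (Fin n)) (i : Fin n) : ℝ :=
  Real.log (1 + sinr ρ g A i)

/-- Throughput of the set `A` of active links. -/
def throughput {n : ℕ} (ρ : ℝ) (g : Fin n → Fin n → ℝ) (A : Finset (Fin n)) : ℝ :=
  ∑ i ∈ A, rate ρ g A i

/-- First phase of DTBLAS: the largest set of links with direct coefficients above `Δ`. -/
def phaseOne {n : ℕ} (g : Fin n → Fin n → ℝ) (Δ : ℝ) : Finset (Fin n) :=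
  Finset.univ.filter fun i => Δ < g i i

/-- The graph on the vertex set `V` that joins two different links when both of their mutual cross
coefficients are at most `δ`. -/
def compatGraph {n : ℕ} (g : Fin n → Fin n → ℝ) (V : Finset (Fin n)) (δ : ℝ) :
    SimpleGraph (Fin n) where
  Adj i j := i ≠ j ∧ i ∈ V ∧ j ∈ V ∧ g i j ≤ δ ∧ g j i ≤ δ
  symm := ⟨fun _ _ h => ⟨h.1.symm, h.2.2.1, h.2.1, h.2.2.2.2, h.2.2.2.1⟩⟩
  loopless := ⟨fun _ h => h.1 rfl⟩

/-- `B` is a complete subgraph of largest size of the graph `G` on the vertex set `V`. -/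
def IsLargestClique {n : ℕ} (V : Finset (Fin n)) (G : SimpleGraph (Fin n))
    (B : Finset (Fin n)) : Prop :=
  B ⊆ V ∧ G.IsClique (B : Set (Fin n)) ∧
    ∀ C : Finset (Fin n), C ⊆ V → G.IsClique (C : Set (Fin n)) → C.card ≤ B.card

/-- A rule for the second phase of DTBLAS: it is given the vertex set and the graph, and returns a
largest complete subgraph. It decides between several largest ones in an arbitrary way, but sees
nothing of the coefficients beyond the graph. -/
def IsPhaseTwoRule
    (sel : ∀ n : ℕ, Finset (Fin n) → SimpleGraph (Fin n) → Finset (Fin n)) : Prop :=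
  ∀ (n : ℕ) (V : Finset (Fin n)) (G : SimpleGraph (Fin n)), IsLargestClique V G (sel n V G)

/-- The set of active links chosen by DTBLAS with thresholds `Δ` and `δ`. -/
def dtblas (sel : ∀ n : ℕ, Finset (Fin n) → SimpleGraph (Fin n) → Finset (Fin n)) {n : ℕ}
    (g : Fin n → Fin n → ℝ) (Δ δ : ℝ) : Finset (Fin n) :=
  sel n (phaseOne g Δ) (compatGraph g (phaseOne g Δ) δ)

/-- The conditional mean `E (X | X ≤ δ)` of an exponential variable `X` with mean `1`. -/
def condMean (δ : ℝ) : ℝ :=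
  ∫ x, x ∂(ProbabilityTheory.cond (expMeasure 1) (Set.Iic δ))

/-- The threshold `Δ₀ = γ₀ (1 / ρ + β)`, where the required rate is `lam = log (1 + γ₀)`. -/
def directThreshold (lam ρ β : ℝ) : ℝ :=
  (Real.exp lam - 1) * (1 / ρ + β)

/-- Asymptotically almost surely, `X n` is as close to `c` as we please: for every `ε > 0` the
probability of `|X n - c| < ε` tends to `1`. The `n`-th network lives on its own space. -/
def LimAAS {Ω : ℕ → Type*} [∀ n, MeasurableSpace (Ω n)] (P : ∀ n, Measure (Ω n))
    (X : ∀ n, Ω n → ℝ) (c : ℝ) : Prop :=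
  ∀ ε : ℝ, 0 < ε → Tendsto (fun n => P n {ω | |X n ω - c| < ε}) atTop (𝓝 1)

end NoiseLimited

end

namespace NoiseLimited

instance isProbabilityMeasure_expMeasure_one : IsProbabilityMeasure (expMeasure 1) :=
  isProbabilityMeasure_expMeasure one_pos

theorem expMeasure_one_eq :
    expMeasure 1 =
      (volume.restrict (Set.Ici 0)).withDensity (fun x : ℝ => ENNReal.ofReal (Real.exp (-x))) := by
  rw [← withDensity_indicator measurableSet_Ici]
  unfold expMeasure gammaMeasure
  congr 1
  ext x
  have h := exponentialPDF_eq 1 x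
  unfold exponentialPDF exponentialPDFReal at h
  unfold gammaPDF
  rw [h]
  by_cases hx : 0 ≤ x
  · simp [hx]
  · simp [hx]

theorem setIntegral_expMeasure_one (f : ℝ → ℝ) {s : Set ℝ} (hs : MeasurableSet s) :
    ∫ x in s, f x ∂expMeasure 1 = ∫ x in s ∩ Set.Ici 0, Real.exp (-x) * f x := by
  rw [expMeasure_one_eq, setIntegral_withDensity_eq_setIntegral_toReal_smul (by fun_prop)
    (by simp) _ hs, Measure.restrict_restrict hs]
  simp [ENNReal.toReal_ofReal (Real.exp_pos _).le]

theorem ae_expMeasure_one_nonneg : ∀ᵐ x ∂expMeasure 1, 0 ≤ x := by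
  rw [expMeasure_one_eq]
  exact (withDensity_absolutelyContinuous _ _).ae_le (ae_restrict_mem measurableSet_Ici)

theorem memLp_two_expMeasure_one : MemLp (fun x : ℝ => x) 2 (expMeasure 1) := by
  rw [memLp_two_iff_integrable_sq (by fun_prop), expMeasure_one_eq,
    integrable_withDensity_iff_integrable_smul' (by fun_prop) (by simp)]
  have h := Real.GammaIntegral_convergent (s := 3) (by norm_num)
  rw [← integrableOn_Ici_iff_integrableOn_Ioi] at h
  refine (integrableOn_congr_fun (fun x hx => ?_) measurableSet_Ici).mp h
  simp only [smul_eq_mul, ENNReal.toReal_ofReal (Real.exp_pos _).le]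
  norm_num

theorem expMeasure_one_real_Iic {d : ℝ} (hd : 0 ≤ d) :
    (expMeasure 1).real (Set.Iic d) = 1 - Real.exp (-d) := by
  rw [← cdf_eq_real, cdf_expMeasure_eq one_pos, if_pos hd, one_mul]

theorem expMeasure_one_Iic_of_nonpos {d : ℝ} (hd : d ≤ 0) :
    expMeasure 1 (Set.Iic d) = 0 := by
  have h0 : (expMeasure 1).real (Set.Iic 0) = 0 := by
    rw [expMeasure_one_real_Iic le_rfl]; simp
  rw [measureReal_eq_zero_iff] at h0
  exact measure_mono_null (Set.Iic_subset_Iic.mpr hd) h0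

theorem expMeasure_one_real_Ioi {d : ℝ} (hd : 0 ≤ d) :
    (expMeasure 1).real (Set.Ioi d) = Real.exp (-d) := by
  rw [← Set.compl_Iic, probReal_compl_eq_one_sub measurableSet_Iic, expMeasure_one_real_Iic hd]
  ring

theorem integral_cond_eq {μ : Measure ℝ} (f : ℝ → ℝ) (s : Set ℝ) :
    ∫ x, f x ∂(ProbabilityTheory.cond μ s) = (μ.real s)⁻¹ * ∫ x in s, f x ∂μ := by
  rw [ProbabilityTheory.cond, integral_smul_measure, ENNReal.toReal_inv]
  rfl

theorem condMean_of_nonpos {d : ℝ} (hd : d ≤ 0) : condMean d = 0 := by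
  rw [condMean, integral_cond_eq, measureReal_def, expMeasure_one_Iic_of_nonpos hd]
  simp

theorem hasDerivAt_firstMoment_primitive (x : ℝ) :
    HasDerivAt (fun x : ℝ => -((1 + x) * Real.exp (-x))) (Real.exp (-x) * x) x := by
  have h := (((hasDerivAt_id x).const_add 1).mul (hasDerivAt_id x).neg.exp).neg
  convert! h using 1
  simp; ring

theorem condMean_of_pos {d : ℝ} (hd : 0 < d) :
    condMean d = 1 - d / (Real.exp d - 1) := by
  have he : 1 < Real.exp d := Real.one_lt_exp_iff.mpr hd
  rw [condMean, integral_cond_eq, expMeasure_one_real_Iic hd.le,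
    setIntegral_expMeasure_one _ measurableSet_Iic, Set.inter_comm, Set.Ici_inter_Iic,
    integral_Icc_eq_integral_Ioc, ← intervalIntegral.integral_of_le hd.le,
    intervalIntegral.integral_eq_sub_of_hasDerivAt
      (fun x _ => hasDerivAt_firstMoment_primitive x)
      (Continuous.intervalIntegrable (by fun_prop) _ _)]
  rw [Real.exp_neg]
  have h1 : Real.exp d ≠ 0 := (Real.exp_pos d).ne'
  have h2 : Real.exp d - 1 ≠ 0 := by linarith
  have h3 : 1 - (Real.exp d)⁻¹ ≠ 0 := by
    have : (Real.exp d)⁻¹ < 1 := inv_lt_one_of_one_lt₀ he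
    linarith
  simp only [neg_zero, Real.exp_zero]
  field_simp
  ring

theorem condMean_nonneg (d : ℝ) : 0 ≤ condMean d := by
  rcases le_or_gt d 0 with hd | hd
  · rw [condMean_of_nonpos hd]
  · have he : 1 < Real.exp d := Real.one_lt_exp_iff.mpr hd
    rw [condMean_of_pos hd, sub_nonneg, div_le_one (by linarith)]
    linarith [Real.add_one_le_exp d]

theorem condMean_mono : Monotone condMean := by
  intro a b hab
  rcases le_or_gt a 0 with ha | ha
  · rw [condMean_of_nonpos ha]; exact condMean_nonneg b
  rcases hab.eq_or_lt with rfl | hab'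
  · rfl
  have hb := ha.trans hab'
  rw [condMean_of_pos ha, condMean_of_pos hb]
  have hA : 1 < Real.exp a := Real.one_lt_exp_iff.mpr ha
  have hB : 1 < Real.exp b := Real.one_lt_exp_iff.mpr hb
  have h := convexOn_exp.secant_mono (a := 0) (x := a) (y := b) trivial trivial trivial ha.ne' hb.ne'
    hab
  simp only [sub_zero, Real.exp_zero] at h
  rw [div_le_div_iff₀ ha hb] at h
  have : b / (Real.exp b - 1) ≤ a / (Real.exp a - 1) := by
    rw [div_le_div_iff₀ (by linarith) (by linarith)]
    linarith
  linarith

theorem abs_condMean_sub_half_le {d : ℝ} (hd : 0 < d) (hd1 : d ≤ 1) :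
    |condMean d - d / 2| ≤ d ^ 2 := by
  have h := Real.exp_bound (x := d) (by rw [abs_of_pos hd]; exact hd1) (n := 3) (by norm_num)
  rw [abs_of_pos hd] at h
  norm_num [Finset.sum_range_succ, Nat.factorial] at h
  rw [abs_le] at h
  have he : d ≤ Real.exp d - 1 := by linarith [Real.add_one_le_exp d]
  have hpos : 0 < Real.exp d - 1 := by linarith
  rw [condMean_of_pos hd]
  set E := Real.exp d with hE
  have key : 1 - d / (E - 1) - d / 2 = ((E - 1) * (1 - d / 2) - d) / (E - 1) := by
    field_simp
    ring
  rw [key, abs_div, abs_of_pos hpos, div_le_iff₀ hpos]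
  have hd3 : 0 < d ^ 3 := by positivity
  have hl : d ^ 3 ≤ d ^ 2 * (E - 1) := by nlinarith [sq_nonneg d]
  refine le_trans ?_ hl
  obtain ⟨h1, h2⟩ := h
  have hd4 : d ^ 4 ≤ d ^ 3 := by nlinarith
  rw [abs_le]
  constructor <;> nlinarith

theorem tendsto_condMean_div {u : ℕ → ℝ} (hu : Tendsto u atTop (𝓝 0))
    (hpos : ∀ᶠ n in atTop, 0 < u n) :
    Tendsto (fun n => condMean (u n) / u n) atTop (𝓝 (1 / 2)) := by
  rw [tendsto_iff_norm_sub_tendsto_zero]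
  refine squeeze_zero' (Eventually.of_forall fun _ => norm_nonneg _) ?_ hu
  filter_upwards [hpos, hu.eventually (gt_mem_nhds one_pos)] with n h0 h1
  have h := abs_condMean_sub_half_le h0 h1.le
  have e : condMean (u n) / u n - 1 / 2 = (condMean (u n) - u n / 2) / u n := by field_simp
  rw [Real.norm_eq_abs, e, abs_div, abs_of_pos h0, div_le_iff₀ h0]
  linarith [sq (u n)]

theorem integral_id_cond_Ioi {d : ℝ} (hd : 0 ≤ d) :
    ∫ x, x ∂(ProbabilityTheory.cond (expMeasure 1) (Set.Ioi d)) = d + 1 := by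
  rw [integral_cond_eq, expMeasure_one_real_Ioi hd,
    setIntegral_expMeasure_one _ measurableSet_Ioi,
    Set.inter_eq_left.mpr (Set.Ioi_subset_Ici hd)]
  have ht : Tendsto (fun x : ℝ => -((1 + x) * Real.exp (-x))) atTop (𝓝 (-(0 + 0))) := by
    refine Tendsto.neg ?_
    simp only [add_mul, one_mul]
    refine Real.tendsto_exp_neg_atTop_nhds_zero.add ?_
    simpa using Real.tendsto_pow_mul_exp_neg_atTop_nhds_zero 1
  rw [integral_Ioi_of_hasDerivAt_of_nonneg'
    (fun x _ => hasDerivAt_firstMoment_primitive x)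
    (fun x hx => mul_nonneg (Real.exp_pos _).le (hd.trans (le_of_lt hx))) ht]
  rw [Real.exp_neg]
  have h1 : Real.exp d ≠ 0 := (Real.exp_pos d).ne'
  field_simp
  ring

theorem memLp_cond {f : ℝ → ℝ} {p : ENNReal} {μ : Measure ℝ} (hf : MemLp f p μ) (s : Set ℝ)
    (hs : μ s ≠ 0) : MemLp f p (ProbabilityTheory.cond μ s) :=
  (hf.restrict s).smul_measure (ENNReal.inv_ne_top.mpr hs)

/-- The limiting mean rate of an active link whose interference is at its asymptotic value. -/
noncomputable def meanRate (c D : ℝ) : ℝ :=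
  ∫ x, Real.log (1 + x / c) ∂(ProbabilityTheory.cond (expMeasure 1) (Set.Ioi D))

theorem memLp_log_one_add_div {c : ℝ} (hc : 0 < c) :
    MemLp (fun x : ℝ => Real.log (1 + x / c)) 2 (expMeasure 1) := by
  refine (memLp_two_expMeasure_one.const_mul c⁻¹).mono
    (Measurable.aestronglyMeasurable (by fun_prop)) ?_
  filter_upwards [ae_expMeasure_one_nonneg] with x hx
  have h : 0 ≤ x / c := by positivity
  rw [Real.norm_of_nonneg (Real.log_nonneg (by linarith)),
    Real.norm_of_nonneg (by positivity)]
  calc Real.log (1 + x / c) ≤ 1 + x / c - 1 := Real.log_le_sub_one_of_pos (by linarith)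
    _ = c⁻¹ * x := by ring

theorem expMeasure_one_Ioi_ne_zero {D : ℝ} (hD : 0 ≤ D) : expMeasure 1 (Set.Ioi D) ≠ 0 := by
  intro h
  have h2 := expMeasure_one_real_Ioi hD
  rw [measureReal_def, h] at h2
  exact (Real.exp_pos (-D)).ne (by simpa using h2)

theorem log_le_meanRate {c D : ℝ} (hc : 0 < c) (hD : 0 ≤ D) :
    Real.log (1 + D / c) ≤ meanRate c D := by
  have hne := expMeasure_one_Ioi_ne_zero hD
  have := cond_isProbabilityMeasure hne
  have hi := ((memLp_cond (memLp_log_one_add_div hc) _ hne).integrable (by norm_num))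
  have h := integral_mono_ae (integrable_const (Real.log (1 + D / c))) hi ?_
  · simpa [meanRate] using h
  · filter_upwards [ae_cond_mem measurableSet_Ioi] with x hx
    have hx' : D < x := hx
    have : 0 ≤ D / c := by positivity
    exact Real.log_le_log (by linarith) (by gcongr)

theorem meanRate_le_log {c D : ℝ} (hc : 0 < c) (hD : 0 ≤ D) :
    meanRate c D ≤ Real.log (1 + (D + 1) / c) := by
  have hne := expMeasure_one_Ioi_ne_zero hD
  have := cond_isProbabilityMeasure hne
  have hi := ((memLp_cond (memLp_log_one_add_div hc) _ hne).integrable (by norm_num))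
  have hid := ((memLp_cond memLp_two_expMeasure_one _ hne).integrable (by norm_num))
  have hsub : Integrable (fun x : ℝ => (x - (D + 1)) / (c + (D + 1)))
      (ProbabilityTheory.cond (expMeasure 1) (Set.Ioi D)) :=
    (hid.sub (integrable_const (D + 1))).div_const (c + (D + 1))
  have h := integral_mono_ae hi ((integrable_const (Real.log (1 + (D + 1) / c))).add hsub) ?_
  · refine h.trans_eq ?_
    simp only [Pi.add_apply]
    rw [integral_add (integrable_const _) hsub, integral_div,
      integral_sub hid (integrable_const _), integral_id_cond_Ioi hD]
    simp
  · filter_upwards [ae_cond_mem measurableSet_Ioi] with x hx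
    have hx' : D < x := hx
    have h1 : 0 < 1 + (D + 1) / c := by positivity
    have h2 : 0 < 1 + x / c := by have := hD.trans_lt hx'; positivity
    have h3 := Real.log_le_sub_one_of_pos (div_pos h2 h1)
    rw [Real.log_div h2.ne' h1.ne'] at h3
    have h4 : (1 + x / c) / (1 + (D + 1) / c) - 1 = (x - (D + 1)) / (c + (D + 1)) := by
      field_simp
      ring
    simp only [Pi.add_apply]
    linarith

/-- The joint law of the channel coefficients of an `n`-link network. -/
noncomputable def chanLaw (n : ℕ) : Measure (Fin n × Fin n → ℝ) :=
  Measure.pi fun _ => expMeasure 1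

instance (n : ℕ) : IsProbabilityMeasure (chanLaw n) := by
  unfold chanLaw; infer_instance

/-- The values of a coefficient that make a link eligible (on the diagonal) or keep the
interference of one link to another small (off the diagonal). -/
def admissible {n : ℕ} (D d : ℝ) (q : Fin n × Fin n) : Set ℝ :=
  if q.1 = q.2 then Set.Ioi D else Set.Iic d

theorem measurableSet_admissible {n : ℕ} (D d : ℝ) (q : Fin n × Fin n) :
    MeasurableSet (admissible D d q) := by
  unfold admissible; split_ifs
  exacts [measurableSet_Ioi, measurableSet_Iic]

/-- The event that all coefficients indexed by `S` are admissible. -/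
def box {n : ℕ} (D d : ℝ) (S : Finset (Fin n × Fin n)) : Set (Fin n × Fin n → ℝ) :=
  {x | ∀ q ∈ S, x q ∈ admissible D d q}

theorem measurableSet_box {n : ℕ} (D d : ℝ) (S : Finset (Fin n × Fin n)) :
    MeasurableSet (box D d S) := by
  have : box D d S = ⋂ q ∈ S, (fun x : Fin n × Fin n → ℝ => x q) ⁻¹' admissible D d q := by
    ext x; simp [box]
  rw [this]
  exact Finset.measurableSet_biInter _ fun q _ =>
    (measurableSet_admissible D d q).preimage (measurable_pi_apply q)

theorem box_inter_box {n : ℕ} (D d : ℝ) (S T : Finset (Fin n × Fin n)) :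
    box D d S ∩ box D d T = box D d (S ∪ T) := by
  ext x
  simp only [box, Set.mem_inter_iff, Set.mem_ofPred_eq, Finset.mem_union]
  constructor
  · rintro ⟨h1, h2⟩ q (hq | hq)
    exacts [h1 q hq, h2 q hq]
  · exact fun h => ⟨fun q hq => h q (Or.inl hq), fun q hq => h q (Or.inr hq)⟩

theorem box_anti {n : ℕ} (D d : ℝ) {S T : Finset (Fin n × Fin n)} (h : S ⊆ T) :
    box D d T ⊆ box D d S :=
  fun _ hx q hq => hx q (h hq)

theorem chanLaw_real_box {n : ℕ} (D d : ℝ) (S : Finset (Fin n × Fin n)) :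
    (chanLaw n).real (box D d S) = ∏ q ∈ S, (expMeasure 1).real (admissible D d q) := by
  have : box D d S =
      Set.univ.pi fun q => if q ∈ S then admissible D d q else Set.univ := by
    ext x
    simp only [box, Set.mem_ofPred_eq, Set.mem_pi, Set.mem_univ, true_imp_iff]
    refine forall_congr' fun q => ?_
    split_ifs with h <;> simp [h]
  rw [this, chanLaw, measureReal_def, Measure.pi_pi, ENNReal.toReal_prod]
  rw [← Finset.prod_subset (Finset.subset_univ S) (fun q _ hq => by simp [hq])]
  exact Finset.prod_congr rfl fun q hq => by simp [hq, measureReal_def]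

theorem chanLaw_real_box_square {n : ℕ} (D d : ℝ) (S : Finset (Fin n)) :
    (chanLaw n).real (box D d (S ×ˢ S)) =
      ((expMeasure 1).real (Set.Ioi D) * (expMeasure 1).real (Set.Iic d) ^ (S.card - 1)) ^
        S.card := by
  rw [chanLaw_real_box, Finset.prod_product, ← Finset.prod_const]
  refine Finset.prod_congr rfl fun i hi => ?_
  rw [← Finset.mul_prod_erase _ _ hi]
  congr 1
  · simp [admissible]
  · rw [← Finset.card_erase_of_mem hi, ← Finset.prod_const]
    refine Finset.prod_congr rfl fun j hj => ?_
    simp [admissible, (Finset.ne_of_mem_erase hj).symm]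

/-- The second moment method for a finite family of events. -/
theorem measureReal_compl_biUnion_mul_sq_le {X ι : Type*} [MeasurableSpace X] (μ : Measure X)
    [IsProbabilityMeasure μ] (I : Finset ι) (E : ι → Set X) (hE : ∀ i, MeasurableSet (E i))
    (hpos : 0 < ∑ i ∈ I, μ.real (E i)) :
    μ.real {x | ∀ i ∈ I, x ∉ E i} * (∑ i ∈ I, μ.real (E i)) ^ 2 ≤
      ∑ i ∈ I, ∑ j ∈ I, μ.real (E i ∩ E j) - (∑ i ∈ I, μ.real (E i)) ^ 2 := by
  set Z : X → ℝ := fun x => ∑ i ∈ I, (E i).indicator (fun _ => (1 : ℝ)) x with hZ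
  have hmem : ∀ i, MemLp ((E i).indicator (fun _ => (1 : ℝ))) 2 μ := fun i =>
    memLp_indicator_const 2 (hE i) 1 (Or.inr (measure_ne_top _ _))
  have hZ2 : MemLp Z 2 μ := memLp_finsetSum I fun i _ => hmem i
  have hmean : ∫ x, Z x ∂μ = ∑ i ∈ I, μ.real (E i) := by
    rw [integral_finsetSum _ fun i _ => (hmem i).integrable (by norm_num)]
    exact Finset.sum_congr rfl fun i _ => by simp [integral_indicator_const _ (hE i)]
  have hsq : ∫ x, (Z ^ 2) x ∂μ = ∑ i ∈ I, ∑ j ∈ I, μ.real (E i ∩ E j) := by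
    have : ∀ x, (Z ^ 2) x =
        ∑ i ∈ I, ∑ j ∈ I, (E i ∩ E j).indicator (fun _ => (1 : ℝ)) x := by
      intro x
      simp only [Pi.pow_apply, sq, hZ, Finset.sum_mul_sum]
      refine Finset.sum_congr rfl fun i _ => Finset.sum_congr rfl fun j _ => ?_
      simpa using (Set.inter_indicator_mul (s := E i) (t := E j) (fun _ => (1 : ℝ))
        (fun _ => (1 : ℝ)) x).symm
    simp only [this]
    have hint : ∀ i j, Integrable ((E i ∩ E j).indicator (fun _ => (1 : ℝ))) μ := fun i j =>
      (integrable_const 1).indicator ((hE i).inter (hE j))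
    rw [integral_finsetSum _ fun i _ => integrable_finsetSum _ fun j _ => hint i j]
    refine Finset.sum_congr rfl fun i _ => ?_
    rw [integral_finsetSum _ fun j _ => hint i j]
    exact Finset.sum_congr rfl fun j _ => by
      simp [integral_indicator_const _ ((hE i).inter (hE j))]
  have hvar := variance_eq_sub hZ2
  rw [hsq, hmean] at hvar
  have hch := meas_ge_le_variance_div_sq hZ2 hpos
  rw [hmean, hvar] at hch
  have hle : μ {x | ∀ i ∈ I, x ∉ E i} ≤ μ {x | ∑ i ∈ I, μ.real (E i) ≤
      |Z x - ∑ i ∈ I, μ.real (E i)|} := by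
    refine measure_mono fun x hx => ?_
    have : Z x = 0 := Finset.sum_eq_zero fun i hi => by simp [hx i hi]
    rw [Set.mem_ofPred_eq, this, zero_sub, abs_neg]
    exact le_abs_self _
  have h0 : 0 ≤ ∑ i ∈ I, ∑ j ∈ I, μ.real (E i ∩ E j) - (∑ i ∈ I, μ.real (E i)) ^ 2 := by
    rw [← hvar]; exact variance_nonneg _ _
  have hr := ENNReal.toReal_mono ENNReal.ofReal_ne_top (hle.trans hch)
  rw [ENNReal.toReal_ofReal (by positivity)] at hr
  rw [← le_div_iff₀ (by positivity)]
  exact hr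

theorem choose_sub_mul_pow_le {n k : ℕ} (hkn : k ≤ n) (l : ℕ) (hl : l ≤ k) :
    (n - l).choose (k - l) * n ^ l ≤ n.choose k * k ^ l := by
  induction l with
  | zero => simp
  | succ l ih =>
    have ih := ih (by omega)
    obtain ⟨m, hm⟩ : ∃ m, n - l = m + 1 := ⟨n - l - 1, by omega⟩
    obtain ⟨j, hj⟩ : ∃ j, k - l = j + 1 := ⟨k - l - 1, by omega⟩
    have hm' : n - (l + 1) = m := by omega
    have hj' : k - (l + 1) = j := by omega
    rw [hm, hj] at ih
    rw [hm', hj']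
    have h1 := Nat.add_one_mul_choose_eq m j
    have h2 : (j + 1) * n ≤ k * (m + 1) := by
      have e1 : n = m + 1 + l := by omega
      have e2 : k = j + 1 + l := by omega
      have h3 : j ≤ m := by omega
      rw [e1, e2]
      nlinarith
    have h4 : m.choose j * n ≤ (m + 1).choose (j + 1) * k := by
      refine Nat.le_of_mul_le_mul_left ?_ (Nat.succ_pos m)
      calc (m + 1) * (m.choose j * n) = (m + 1).choose (j + 1) * ((j + 1) * n) := by
            rw [← mul_assoc, h1, mul_assoc]
        _ ≤ (m + 1).choose (j + 1) * (k * (m + 1)) := Nat.mul_le_mul_left _ h2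
        _ = (m + 1) * ((m + 1).choose (j + 1) * k) := by ring
    calc m.choose j * n ^ (l + 1) = (m.choose j * n) * n ^ l := by ring
      _ ≤ ((m + 1).choose (j + 1) * k) * n ^ l := Nat.mul_le_mul_right _ h4
      _ = ((m + 1).choose (j + 1) * n ^ l) * k := by ring
      _ ≤ (n.choose k * k ^ l) * k := Nat.mul_le_mul_right _ ih
      _ = _ := by ring

theorem card_filter_superset_le {n k : ℕ} (hkn : k ≤ n) (hn : 0 < n) (U : Finset (Fin n))
    (hU : U.card ≤ k) :
    (((Finset.powersetCard k (Finset.univ : Finset (Fin n))).filter (U ⊆ ·)).card : ℝ) ≤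
      n.choose k * ((k : ℝ) / n) ^ U.card := by
  have h1 : ((Finset.powersetCard k (Finset.univ : Finset (Fin n))).filter (U ⊆ ·)).card ≤
      (Finset.powersetCard (k - U.card) (Finset.univ \ U)).card := by
    refine Finset.card_le_card_of_injOn (fun T => T \ U) (fun T hT => ?_) ?_
    · simp only [Finset.coe_filter, Finset.mem_powersetCard, Set.mem_ofPred_eq] at hT
      exact Finset.mem_coe.mpr <| Finset.mem_powersetCard.mpr ⟨Finset.sdiff_subset_sdiff (Finset.subset_univ T) le_rfl, by
        rw [Finset.card_sdiff_of_subset hT.2, hT.1.2]⟩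
    · intro T hT T' hT' h
      simp only [Finset.coe_filter, Finset.mem_powersetCard, Set.mem_ofPred_eq] at hT hT'
      rw [← Finset.sdiff_union_of_subset hT.2, ← Finset.sdiff_union_of_subset hT'.2]
      exact congrArg (· ∪ U) h
  rw [Finset.card_powersetCard, Finset.card_sdiff_of_subset (Finset.subset_univ U),
    Finset.card_univ, Fintype.card_fin] at h1
  have h2 := choose_sub_mul_pow_le hkn U.card hU
  have hn' : (0 : ℝ) < n := Nat.cast_pos.mpr hn
  rw [div_pow, ← mul_div_assoc, le_div_iff₀ (by positivity)]
  exact_mod_cast (Nat.mul_le_mul_right _ h1).trans h2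

theorem chanLaw_real_forall_notMem_box_le {n k : ℕ} (hkn : k ≤ n) (hn : 0 < n) {D d : ℝ}
    (hr : 0 < (expMeasure 1).real (Set.Ioi D)) (hp : 0 < (expMeasure 1).real (Set.Iic d)) :
    (chanLaw n).real {x | ∀ S : Finset (Fin n), S.card = k → x ∉ box D d (S ×ˢ S)} ≤
      (1 + k / n * ((expMeasure 1).real (Set.Ioi D) *
        (expMeasure 1).real (Set.Iic d) ^ (k - 1))⁻¹) ^ k - 1 := by
  set r := (expMeasure 1).real (Set.Ioi D)
  set p := (expMeasure 1).real (Set.Iic d)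
  have hp1 : p ≤ 1 := measureReal_le_one
  set y : ℝ := k / n * (r * p ^ (k - 1))⁻¹ with hy
  set I := Finset.powersetCard k (Finset.univ : Finset (Fin n)) with hI
  set w : Finset (Fin n) → ℝ := fun S => (chanLaw n).real (box D d (S ×ˢ S)) with hw
  have hwc : ∀ S, w S = (r * p ^ (S.card - 1)) ^ S.card := chanLaw_real_box_square D d
  have hwpos : ∀ S, 0 < w S := fun S => by rw [hwc]; positivity
  have hwinv : ∀ U : Finset (Fin n), U.card ≤ k →
      (w U)⁻¹ ≤ ((r * p ^ (k - 1))⁻¹) ^ U.card := by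
    intro U hU
    rw [hwc, inv_pow]
    have : p ^ (k - 1) ≤ p ^ (U.card - 1) := pow_le_pow_of_le_one hp.le hp1 (by omega)
    gcongr
  set W := (r * p ^ (k - 1)) ^ k with hW
  have hWI : ∀ S ∈ I, w S = W := fun S hS => by
    rw [hwc, (Finset.mem_powersetCard.mp hS).2]
  have hWpos : 0 < W := by positivity
  have hN : (I.card : ℝ) = n.choose k := by
    rw [hI, Finset.card_powersetCard, Finset.card_univ, Fintype.card_fin]
  have hNpos : (0 : ℝ) < n.choose k := Nat.cast_pos.mpr (Nat.choose_pos hkn)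
  have hsum : ∑ S ∈ I, w S = n.choose k * W := by
    rw [Finset.sum_congr rfl hWI, Finset.sum_const, nsmul_eq_mul, hN]
  have hpair : ∀ S ∈ I, ∀ T ∈ I,
      (chanLaw n).real (box D d (S ×ˢ S) ∩ box D d (T ×ˢ T)) = W ^ 2 * (w (S ∩ T))⁻¹ := by
    intro S hS T hT
    rw [eq_mul_inv_iff_mul_eq₀ (hwpos _).ne', sq]
    nth_rewrite 1 [← hWI S hS]
    rw [← hWI T hT, box_inter_box]
    simp only [hw, chanLaw_real_box]
    rw [← Finset.product_inter_product, Finset.prod_union_inter]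
  have hinner : ∀ S ∈ I, ∑ T ∈ I,
      (chanLaw n).real (box D d (S ×ˢ S) ∩ box D d (T ×ˢ T)) ≤
        W ^ 2 * (n.choose k * (1 + y) ^ k) := by
    intro S hS
    have hSc : S.card = k := (Finset.mem_powersetCard.mp hS).2
    rw [Finset.sum_congr rfl (hpair S hS), ← Finset.mul_sum]
    refine mul_le_mul_of_nonneg_left ?_ (by positivity)
    calc ∑ T ∈ I, (w (S ∩ T))⁻¹
        ≤ ∑ T ∈ I, ∑ U ∈ S.powerset, if U ⊆ T then (w U)⁻¹ else 0 := by
          refine Finset.sum_le_sum fun T _ => ?_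
          have h := Finset.single_le_sum (s := S.powerset)
            (f := fun U => if U ⊆ T then (w U)⁻¹ else 0)
            (fun U _ => by
              have := (hwpos U).le
              split_ifs <;> positivity)
            (Finset.mem_powerset.mpr (Finset.inter_subset_left (s₁ := S) (s₂ := T)))
          simpa [Finset.inter_subset_right] using h
      _ = ∑ U ∈ S.powerset, ((I.filter (U ⊆ ·)).card : ℝ) * (w U)⁻¹ := by
          rw [Finset.sum_comm]
          refine Finset.sum_congr rfl fun U _ => ?_
          rw [← Finset.sum_filter, Finset.sum_const, nsmul_eq_mul]
      _ ≤ ∑ U ∈ S.powerset, n.choose k * y ^ U.card := by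
          refine Finset.sum_le_sum fun U hU => ?_
          have hUk : U.card ≤ k := hSc ▸ Finset.card_le_card (Finset.mem_powerset.mp hU)
          rw [hy, mul_pow, ← mul_assoc]
          exact mul_le_mul (card_filter_superset_le hkn hn U hUk) (hwinv U hUk)
            (inv_nonneg.mpr (hwpos U).le) (by positivity)
      _ = n.choose k * (1 + y) ^ k := by
          rw [← Finset.mul_sum, ← hSc, add_comm (1 : ℝ)]
          congr 1
          have := Finset.sum_pow_mul_eq_add_pow y 1 S
          simpa using this
  have hmain := measureReal_compl_biUnion_mul_sq_le (chanLaw n) I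
    (fun S => box D d (S ×ˢ S)) (fun S => measurableSet_box D d _)
    (by change 0 < ∑ S ∈ I, w S; rw [hsum]; positivity)
  change _ * (∑ S ∈ I, w S) ^ 2 ≤ _ - (∑ S ∈ I, w S) ^ 2 at hmain
  rw [hsum] at hmain
  have hdouble := Finset.sum_le_sum hinner
  rw [Finset.sum_const, nsmul_eq_mul, hN] at hdouble
  have hset : {x : Fin n × Fin n → ℝ |
      ∀ S : Finset (Fin n), S.card = k → x ∉ box D d (S ×ˢ S)} =
      {x | ∀ S ∈ I, x ∉ box D d (S ×ˢ S)} := by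
    ext x; simp [hI, Finset.mem_powersetCard]
  rw [hset]
  have hsqpos : 0 < ((n.choose k : ℝ) * W) ^ 2 := by positivity
  refine le_of_mul_le_mul_right (hmain.trans ?_) hsqpos
  have : (n.choose k : ℝ) * (W ^ 2 * (n.choose k * (1 + y) ^ k)) =
      (1 + y) ^ k * ((n.choose k : ℝ) * W) ^ 2 := by ring
  rw [this] at hdouble
  linarith

theorem chanLaw_real_exists_mem_box_le {n : ℕ} (k : ℕ) (D d : ℝ) :
    (chanLaw n).real {x | ∃ S : Finset (Fin n), k ≤ S.card ∧ x ∈ box D d (S ×ˢ S)} ≤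
      (n * (expMeasure 1).real (Set.Iic d) ^ (k - 1)) ^ k := by
  set r := (expMeasure 1).real (Set.Ioi D)
  set p := (expMeasure 1).real (Set.Iic d)
  have hp0 : 0 ≤ p := measureReal_nonneg
  have hr0 : 0 ≤ r := measureReal_nonneg
  have hr1 : r ≤ 1 := measureReal_le_one
  set I := Finset.powersetCard k (Finset.univ : Finset (Fin n)) with hI
  have hsub : {x | ∃ S : Finset (Fin n), k ≤ S.card ∧ x ∈ box D d (S ×ˢ S)} ⊆
      ⋃ S ∈ I, box D d (S ×ˢ S) := by
    rintro x ⟨S, hS, hx⟩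
    obtain ⟨T, hTS, hT⟩ := Finset.exists_subset_card_eq hS
    simp only [Set.mem_iUnion]
    exact ⟨T, Finset.mem_powersetCard.mpr ⟨Finset.subset_univ T, hT⟩,
      box_anti D d (Finset.product_subset_product hTS hTS) hx⟩
  calc _ ≤ (chanLaw n).real (⋃ S ∈ I, box D d (S ×ˢ S)) := measureReal_mono hsub (measure_ne_top _ _)
    _ ≤ ∑ S ∈ I, (chanLaw n).real (box D d (S ×ˢ S)) := measureReal_biUnion_finset_le _ _
    _ = ∑ S ∈ I, (r * p ^ (k - 1)) ^ k := Finset.sum_congr rfl fun S hS => by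
        rw [chanLaw_real_box_square, (Finset.mem_powersetCard.mp hS).2]
    _ = n.choose k * (r * p ^ (k - 1)) ^ k := by
        rw [Finset.sum_const, nsmul_eq_mul, hI, Finset.card_powersetCard, Finset.card_univ,
          Fintype.card_fin]
    _ ≤ (n : ℝ) ^ k * (1 * p ^ (k - 1)) ^ k := by
        gcongr
        exact_mod_cast Nat.choose_le_pow n k
    _ = _ := by rw [one_mul, ← mul_pow]

/-- The scale `log log n / log n`, the reciprocal of the asymptotic number of active links. -/
noncomputable def scale (n : ℕ) : ℝ :=
  Real.log (Real.log n) / Real.log n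

theorem tendsto_log_natCast : Tendsto (fun n : ℕ => Real.log n) atTop atTop :=
  Real.tendsto_log_atTop.comp tendsto_natCast_atTop_atTop

theorem tendsto_log_log_natCast : Tendsto (fun n : ℕ => Real.log (Real.log n)) atTop atTop :=
  Real.tendsto_log_atTop.comp tendsto_log_natCast

theorem tendsto_log_div_self {u : ℕ → ℝ} (hu : Tendsto u atTop atTop) :
    Tendsto (fun n => Real.log (u n) / u n) atTop (𝓝 0) :=
  (Real.isLittleO_log_id_atTop.tendsto_div_nhds_zero).comp hu

theorem tendsto_scale : Tendsto scale atTop (𝓝 0) :=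
  tendsto_log_div_self tendsto_log_natCast

theorem eventually_scale_pos : ∀ᶠ n in atTop, 0 < scale n := by
  filter_upwards [tendsto_log_natCast.eventually_gt_atTop 0,
    tendsto_log_log_natCast.eventually_gt_atTop 0] with n h1 h2
  exact div_pos h2 h1

variable {d : ℕ → ℝ} {a : ℝ}

theorem tendsto_zero_of_div_scale (hd : Tendsto (fun n => d n / scale n) atTop (𝓝 a)) :
    Tendsto d atTop (𝓝 0) := by
  have h := hd.mul tendsto_scale
  rw [mul_zero] at h
  refine h.congr' ?_
  filter_upwards [eventually_scale_pos] with n hn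
  exact div_mul_cancel₀ _ hn.ne'

theorem eventually_pos_of_div_scale (ha : 0 < a)
    (hd : Tendsto (fun n => d n / scale n) atTop (𝓝 a)) : ∀ᶠ n in atTop, 0 < d n := by
  filter_upwards [eventually_scale_pos, hd.eventually (lt_mem_nhds ha)] with n hn h
  exact (div_pos_iff_of_pos_right hn).mp h

theorem expMeasure_one_real_Iic_pos {t : ℝ} (ht : 0 < t) :
    0 < (expMeasure 1).real (Set.Iic t) := by
  rw [expMeasure_one_real_Iic ht.le, sub_pos, Real.exp_lt_one_iff]
  linarith

theorem tendsto_expMeasure_one_Iic_div_scale (ha : 0 < a)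
    (hd : Tendsto (fun n => d n / scale n) atTop (𝓝 a)) :
    Tendsto (fun n => (expMeasure 1).real (Set.Iic (d n)) / scale n) atTop (𝓝 a) := by
  have h1 : Tendsto (fun n => d n / scale n * (1 - d n)) atTop (𝓝 a) := by
    simpa using hd.mul ((tendsto_zero_of_div_scale hd).const_sub 1)
  refine tendsto_of_tendsto_of_tendsto_of_le_of_le' h1 hd ?_ ?_
  · filter_upwards [eventually_scale_pos, eventually_pos_of_div_scale ha hd,
      (tendsto_zero_of_div_scale hd).eventually (gt_mem_nhds one_pos)] with n hs hp h1
    rw [expMeasure_one_real_Iic hp.le, div_mul_eq_mul_div]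
    refine div_le_div_of_nonneg_right ?_ hs.le
    have h2 : Real.exp (-d n) * (1 + d n) ≤ 1 := by
      rw [Real.exp_neg, inv_mul_le_one₀ (Real.exp_pos _)]
      linarith [Real.add_one_le_exp (d n)]
    have h3 : Real.exp (-d n) ≤ 1 - d n + d n ^ 2 := by
      by_contra! hcon
      nlinarith [pow_pos hp 3]
    nlinarith
  · filter_upwards [eventually_scale_pos, eventually_pos_of_div_scale ha hd] with n hs hp
    rw [expMeasure_one_real_Iic hp.le]
    refine div_le_div_of_nonneg_right ?_ hs.le
    linarith [Real.add_one_le_exp (-d n)]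

theorem tendsto_log_expMeasure_one_Iic_div (ha : 0 < a)
    (hd : Tendsto (fun n => d n / scale n) atTop (𝓝 a)) :
    Tendsto (fun n : ℕ => Real.log ((expMeasure 1).real (Set.Iic (d n))) /
      Real.log (Real.log n)) atTop (𝓝 (-1)) := by
  have h1 := ((tendsto_expMeasure_one_Iic_div_scale ha hd).log ha.ne').div_atTop
    tendsto_log_log_natCast
  have h2 := tendsto_log_div_self tendsto_log_log_natCast
  have h3 := (h1.add h2).sub_const 1
  rw [add_zero, zero_sub] at h3
  refine h3.congr' ?_
  filter_upwards [eventually_scale_pos, eventually_pos_of_div_scale ha hd,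
    tendsto_log_natCast.eventually_gt_atTop 0,
    tendsto_log_log_natCast.eventually_gt_atTop 0] with n hs hp hl hll
  rw [Real.log_div (expMeasure_one_real_Iic_pos hp).ne' hs.ne', scale,
    Real.log_div hll.ne' hl.ne']
  field_simp
  ring

theorem tendsto_natCeil_div_scale_mul {κ : ℝ} (hκ : 0 < κ) :
    Tendsto (fun n => (⌈κ / scale n⌉₊ : ℝ) * scale n) atTop (𝓝 κ) := by
  have h : Tendsto (fun n => κ + scale n) atTop (𝓝 κ) := by
    simpa using tendsto_scale.const_add κ
  refine tendsto_of_tendsto_of_tendsto_of_le_of_le' tendsto_const_nhds h ?_ ?_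
  · filter_upwards [eventually_scale_pos] with n hs
    rw [← div_le_iff₀ hs]
    exact Nat.le_ceil _
  · filter_upwards [eventually_scale_pos] with n hs
    have := (Nat.ceil_lt_add_one (div_pos hκ hs).le).le
    calc (⌈κ / scale n⌉₊ : ℝ) * scale n ≤ (κ / scale n + 1) * scale n := by gcongr
      _ = κ + scale n := by field_simp

theorem tendsto_log_mul_pow_div {κ : ℝ} (hκ : 0 < κ) (ha : 0 < a)
    (hd : Tendsto (fun n => d n / scale n) atTop (𝓝 a)) :
    Tendsto (fun n : ℕ => Real.log (n * (expMeasure 1).real (Set.Iic (d n)) ^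
      (⌈κ / scale n⌉₊ - 1)) / Real.log n) atTop (𝓝 (1 - κ)) := by
  have h := (((tendsto_natCeil_div_scale_mul hκ).sub tendsto_scale).mul
    (tendsto_log_expMeasure_one_Iic_div ha hd)).const_add 1
  have e : 1 + (κ - 0) * -1 = 1 - κ := by ring
  rw [e] at h
  refine h.congr' ?_
  filter_upwards [eventually_scale_pos, eventually_pos_of_div_scale ha hd,
    tendsto_log_natCast.eventually_gt_atTop 0,
    tendsto_log_log_natCast.eventually_gt_atTop 0, eventually_gt_atTop 0] with n hs hp hl hll hn
  have hk : 1 ≤ ⌈κ / scale n⌉₊ := Nat.one_le_ceil_iff.mpr (div_pos hκ hs)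
  have hn' : (n : ℝ) ≠ 0 := by exact_mod_cast hn.ne'
  rw [Real.log_mul hn' (pow_pos (expMeasure_one_real_Iic_pos hp) _).ne', Real.log_pow,
    Nat.cast_sub hk, Nat.cast_one]
  have hs' : scale n * Real.log n = Real.log (Real.log n) := by
    rw [scale]; field_simp
  rw [← hs']
  field_simp

theorem tendsto_chanLaw_exists_large_clique {κ : ℝ} (hκ : 1 < κ) (D : ℝ) (ha : 0 < a)
    (hd : Tendsto (fun n => d n / scale n) atTop (𝓝 a)) :
    Tendsto (fun n => (chanLaw n).real {x | ∃ S : Finset (Fin n),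
      κ / scale n ≤ S.card ∧ x ∈ box D (d n) (S ×ˢ S)}) atTop (𝓝 0) := by
  have hκ0 := one_pos.trans hκ
  have hlog : Tendsto (fun n : ℕ => Real.log (n * (expMeasure 1).real (Set.Iic (d n)) ^
      (⌈κ / scale n⌉₊ - 1))) atTop atBot := by
    have h := (tendsto_log_mul_pow_div hκ0 ha hd).neg_mul_atTop (by linarith)
      tendsto_log_natCast
    refine h.congr' ?_
    filter_upwards [tendsto_log_natCast.eventually_gt_atTop 0] with n hl
    exact div_mul_cancel₀ _ hl.ne'
  refine squeeze_zero' (Eventually.of_forall fun _ => measureReal_nonneg) ?_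
    (Real.tendsto_exp_atBot.comp hlog)
  filter_upwards [eventually_scale_pos, eventually_pos_of_div_scale ha hd,
    hlog.eventually_le_atBot 0, eventually_gt_atTop 0] with n hs hp hneg hn
  have hk : 1 ≤ ⌈κ / scale n⌉₊ := Nat.one_le_ceil_iff.mpr (div_pos hκ0 hs)
  have hn' : (0 : ℝ) < n := by exact_mod_cast hn
  have hpos : 0 < n * (expMeasure 1).real (Set.Iic (d n)) ^ (⌈κ / scale n⌉₊ - 1) :=
    mul_pos hn' (pow_pos (expMeasure_one_real_Iic_pos hp) _)
  simp only [Function.comp]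
  rw [Real.exp_log hpos]
  have h := chanLaw_real_exists_mem_box_le (n := n) ⌈κ / scale n⌉₊ D (d n)
  simp only [Nat.ceil_le] at h
  refine h.trans (pow_le_of_le_one hpos.le ?_ (by omega))
  rwa [Real.log_nonpos_iff hpos.le] at hneg

theorem tendsto_chanLaw_no_clique {κ : ℝ} (hκ0 : 0 < κ) (hκ : κ < 1) {D : ℝ} (hD : 0 ≤ D)
    (ha : 0 < a) (hd : Tendsto (fun n => d n / scale n) atTop (𝓝 a)) :
    Tendsto (fun n => (chanLaw n).real {x | ¬ ∃ S : Finset (Fin n),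
      κ / scale n ≤ S.card ∧ x ∈ box D (d n) (S ×ˢ S)}) atTop (𝓝 0) := by
  set r := (expMeasure 1).real (Set.Ioi D) with hr
  have hrpos : 0 < r := by rw [hr, expMeasure_one_real_Ioi hD]; exact Real.exp_pos _
  have hkl : ∀ᶠ n : ℕ in atTop, (⌈κ / scale n⌉₊ : ℝ) ≤ Real.log n := by
    filter_upwards [(tendsto_natCeil_div_scale_mul hκ0).eventually (gt_mem_nhds hκ),
      tendsto_log_natCast.eventually_gt_atTop 0,
      tendsto_log_log_natCast.eventually_ge_atTop 1] with n h1 hl hll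
    generalize ⌈κ / scale n⌉₊ = k at h1 ⊢
    rw [scale, ← mul_div_assoc, div_lt_one hl] at h1
    nlinarith [Nat.cast_nonneg (α := ℝ) k]
  have hbound : Tendsto (fun n : ℕ => Real.exp (r⁻¹ * (Real.log n ^ 2 *
      Real.exp (-((1 - κ) / 2 * Real.log n)))) - 1) atTop (𝓝 0) := by
    have h1 := (Real.tendsto_pow_mul_exp_neg_atTop_nhds_zero 2).comp
      (tendsto_log_natCast.const_mul_atTop (show 0 < (1 - κ) / 2 by linarith))
    have h2 := (h1.const_mul (r⁻¹ * (((1 - κ) / 2) ^ 2)⁻¹)).rexp.sub_const 1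
    rw [mul_zero, Real.exp_zero, sub_self] at h2
    refine h2.congr fun n => ?_
    simp only [Function.comp]
    have : 1 - κ ≠ 0 := by linarith
    congr 2
    field_simp
  refine squeeze_zero' (Eventually.of_forall fun _ => measureReal_nonneg) ?_ hbound
  filter_upwards [eventually_scale_pos, eventually_pos_of_div_scale ha hd, hkl,
    eventually_gt_atTop 0, tendsto_log_natCast.eventually_gt_atTop 0,
    (tendsto_log_mul_pow_div hκ0 ha hd).eventually
      (lt_mem_nhds (show (1 - κ) / 2 < 1 - κ by linarith))] with n hs hp hk hn hl hlog
  set k := ⌈κ / scale n⌉₊ with hkdef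
  set p := (expMeasure 1).real (Set.Iic (d n)) with hpdef
  have hn' : (0 : ℝ) < n := by exact_mod_cast hn
  have hppos : 0 < p := expMeasure_one_real_Iic_pos hp
  have hkn : k ≤ n := by
    have := hk.trans (Real.log_le_self hn'.le)
    exact_mod_cast this
  have h := chanLaw_real_forall_notMem_box_le (D := D) (d := d n) hkn hn hrpos hppos
  have hsub : {x : Fin n × Fin n → ℝ | ¬ ∃ S : Finset (Fin n),
      κ / scale n ≤ S.card ∧ x ∈ box D (d n) (S ×ˢ S)} ⊆
      {x | ∀ S : Finset (Fin n), S.card = k → x ∉ box D (d n) (S ×ˢ S)} := by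
    intro x hx S hS hxS
    exact hx ⟨S, by rw [hS, hkdef]; exact Nat.le_ceil _, hxS⟩
  refine (measureReal_mono hsub).trans (h.trans ?_)
  rw [← hr, ← hpdef]
  have hy0 : 0 ≤ (k : ℝ) / n * (r * p ^ (k - 1))⁻¹ := by positivity
  have hexp : (1 + (k : ℝ) / n * (r * p ^ (k - 1))⁻¹) ^ k ≤
      Real.exp (k * ((k : ℝ) / n * (r * p ^ (k - 1))⁻¹)) := by
    rw [Real.exp_nat_mul]
    refine pow_le_pow_left₀ (by linarith) ?_ _
    linarith [Real.add_one_le_exp ((k : ℝ) / n * (r * p ^ (k - 1))⁻¹)]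
  refine sub_le_sub_right (hexp.trans (Real.exp_le_exp.mpr ?_)) 1
  have hnp : 0 < n * p ^ (k - 1) := by positivity
  rw [lt_div_iff₀ hl] at hlog
  have hinv : (n * p ^ (k - 1))⁻¹ ≤ Real.exp (-((1 - κ) / 2 * Real.log n)) := by
    rw [Real.exp_neg]
    refine inv_anti₀ (Real.exp_pos _) ?_
    rw [← Real.exp_log hnp]
    exact Real.exp_le_exp.mpr hlog.le
  calc (k : ℝ) * ((k : ℝ) / n * (r * p ^ (k - 1))⁻¹)
      = r⁻¹ * ((k : ℝ) ^ 2 * (n * p ^ (k - 1))⁻¹) := by field_simp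
    _ ≤ _ := by gcongr

section Product

variable {ι α : Type*} [Fintype ι] {μ : ι → Measure ℝ} [∀ i, IsProbabilityMeasure (μ i)]
  {s : Finset α} {e : α → ι} {f : ℝ → ℝ}

theorem memLp_comp_eval {i : ι} (hf : MemLp f 2 (μ i)) :
    MemLp (fun x : ι → ℝ => f (x i)) 2 (Measure.pi μ) :=
  hf.comp_measurePreserving (measurePreserving_eval μ i)

theorem memLp_sum_eval (hf : ∀ a ∈ s, MemLp f 2 (μ (e a))) :
    MemLp (fun x : ι → ℝ => ∑ a ∈ s, f (x (e a))) 2 (Measure.pi μ) :=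
  memLp_finsetSum s fun a ha => memLp_comp_eval (hf a ha)

theorem integral_sum_eval (hf : ∀ a ∈ s, MemLp f 2 (μ (e a))) :
    ∫ x, ∑ a ∈ s, f (x (e a)) ∂Measure.pi μ = ∑ a ∈ s, ∫ t, f t ∂μ (e a) := by
  rw [integral_finsetSum _ fun a ha => (memLp_comp_eval (hf a ha)).integrable (by norm_num)]
  exact Finset.sum_congr rfl fun a ha => integral_comp_eval (hf a ha).1

theorem variance_sum_eval (he : Set.InjOn e s) (hmeas : Measurable f)
    (hf : ∀ a ∈ s, MemLp f 2 (μ (e a))) :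
    Var[fun x : ι → ℝ => ∑ a ∈ s, f (x (e a)); Measure.pi μ] =
      ∑ a ∈ s, Var[f; μ (e a)] := by
  have hind : iIndepFun (fun (i : ι) (x : ι → ℝ) => f (x i)) (Measure.pi μ) :=
    iIndepFun_pi fun i => hmeas.aemeasurable
  have h := IndepFun.variance_sum (μ := Measure.pi μ) (X := fun a (x : ι → ℝ) => f (x (e a)))
    (s := s) (fun a ha => memLp_comp_eval (hf a ha))
    (fun a ha b hb hab => hind.indepFun fun h => hab (he ha hb h))
  have hfun : (fun x : ι → ℝ => ∑ a ∈ s, f (x (e a))) =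
      ∑ a ∈ s, fun (x : ι → ℝ) => f (x (e a)) := by
    ext x; simp
  rw [hfun, h]
  refine Finset.sum_congr rfl fun a _ => ?_
  change Var[f ∘ (fun x : ι → ℝ => x (e a)); Measure.pi μ] = _
  rw [← variance_map, (measurePreserving_eval μ (e a)).map_eq]
  · exact hmeas.aemeasurable
  · exact (measurable_pi_apply _).aemeasurable

end Product

theorem cond_pi_eq {ι : Type*} [Fintype ι] {μ : ι → Measure ℝ} [∀ i, IsFiniteMeasure (μ i)]
    {C : ι → Set ℝ} (hC : ∀ i, MeasurableSet (C i))
    (hne : ∀ i, μ i (C i) ≠ 0) :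
    ProbabilityTheory.cond (Measure.pi μ) (Set.univ.pi C) =
      Measure.pi fun i => ProbabilityTheory.cond (μ i) (C i) := by
  have := fun i => cond_isProbabilityMeasure (hne i)
  refine (Measure.pi_eq fun t ht => ?_).symm
  rw [cond_apply (MeasurableSet.univ_pi hC), ← Set.pi_inter_distrib, Measure.pi_pi,
    Measure.pi_pi, ENNReal.prod_inv_distrib, ← Finset.prod_mul_distrib]
  · exact Finset.prod_congr rfl fun i _ => (cond_apply (hC i) _ _).symm
  · exact fun i _ j _ _ => Or.inl (hne i)

theorem ae_cond_Iic_mem_Icc (d : ℝ) :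
    ∀ᵐ t ∂(ProbabilityTheory.cond (expMeasure 1) (Set.Iic d)), t ∈ Set.Icc 0 d := by
  filter_upwards [ae_cond_mem measurableSet_Iic,
    (cond_absolutelyContinuous (s := Set.Iic d)).ae_le ae_expMeasure_one_nonneg] with t h1 h2
  exact ⟨h2, h1⟩

/-- How far the interferences at the active links, and the sum of the rates that these links would
have at the interference level `c - 1 / ρ`, are from their means. -/
noncomputable def deviation {n : ℕ} (ρ c D d : ℝ) (B : Finset (Fin n))
    (x : Fin n × Fin n → ℝ) : ℝ :=
  ρ * ∑ i ∈ B, |interference (Function.curry x) B i - (B.card - 1) * condMean d| +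
    |∑ i ∈ B, Real.log (1 + x (i, i) / c) - B.card * meanRate c D|

theorem abs_log_one_add_div_sub_le {s u v a : ℝ} (hs : 0 < s) (hu : 0 ≤ u) (hv : 0 ≤ v)
    (ha : 0 ≤ a) :
    |Real.log (1 + a / (s + u)) - Real.log (1 + a / (s + v))| ≤ 1 / s * |u - v| := by
  wlog huv : u ≤ v generalizing u v
  · rw [abs_sub_comm, abs_sub_comm u]
    exact this hv hu (by linarith)
  have h1 : 0 < s + u := by linarith
  have h2 : 0 < s + v := by linarith
  have hle : Real.log (1 + a / (s + v)) ≤ Real.log (1 + a / (s + u)) :=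
    Real.log_le_log (by positivity) (by gcongr)
  rw [abs_of_nonneg (by linarith), abs_of_nonpos (by linarith)]
  have hA : 0 < 1 + a / (s + u) := by positivity
  have hB : 0 < 1 + a / (s + v) := by positivity
  rw [← Real.log_div hA.ne' hB.ne']
  refine (Real.log_le_sub_one_of_pos (by positivity)).trans ?_
  have e : (1 + a / (s + u)) / (1 + a / (s + v)) - 1 =
      a / (s + v + a) * (1 / (s + u)) * (v - u) := by
    field_simp
    ring
  rw [e, neg_sub]
  refine mul_le_mul_of_nonneg_right ?_ (by linarith)
  calc a / (s + v + a) * (1 / (s + u)) ≤ 1 * (1 / s) := by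
        gcongr
        · exact div_le_one_of_le₀ (by linarith) (by linarith)
        · linarith
    _ = 1 / s := one_mul _

theorem abs_throughput_sub_le {n : ℕ} {ρ β D d : ℝ} (hρ : 0 < ρ) (hβ : 0 ≤ β)
    (B : Finset (Fin n)) {x : Fin n × Fin n → ℝ} (hx : ∀ q, 0 ≤ x q) :
    |throughput ρ (Function.curry x) B - B.card * meanRate (1 / ρ + β) D| ≤
      deviation ρ (1 / ρ + β) D d B x + B.card * (ρ * |(B.card - 1) * condMean d - β|) := by
  have hrate : ∀ i ∈ B, |rate ρ (Function.curry x) B i -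
      Real.log (1 + x (i, i) / (1 / ρ + β))| ≤
      ρ * |interference (Function.curry x) B i - (B.card - 1) * condMean d| +
        ρ * |(B.card - 1) * condMean d - β| := by
    intro i _
    have h := abs_log_one_add_div_sub_le (s := 1 / ρ)
      (u := interference (Function.curry x) B i) (v := β) (a := x (i, i)) (by positivity)
      (Finset.sum_nonneg fun j _ => hx _) hβ (hx _)
    rw [one_div_one_div] at h
    refine h.trans ?_
    rw [← mul_add]
    exact mul_le_mul_of_nonneg_left (abs_sub_le _ _ _) hρ.le
  have hsum : |throughput ρ (Function.curry x) B -
      ∑ i ∈ B, Real.log (1 + x (i, i) / (1 / ρ + β))| ≤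
      ρ * ∑ i ∈ B, |interference (Function.curry x) B i - (B.card - 1) * condMean d| +
        B.card * (ρ * |(B.card - 1) * condMean d - β|) := by
    rw [throughput, ← Finset.sum_sub_distrib]
    refine (Finset.abs_sum_le_sum_abs _ _).trans ((Finset.sum_le_sum hrate).trans_eq ?_)
    rw [Finset.sum_add_distrib, Finset.mul_sum, Finset.sum_const, nsmul_eq_mul]
  have htri := abs_sub_le (throughput ρ (Function.curry x) B)
    (∑ i ∈ B, Real.log (1 + x (i, i) / (1 / ρ + β))) (B.card * meanRate (1 / ρ + β) D)
  rw [deviation]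
  linarith

section Chebyshev

variable {n : ℕ} {ρ c D d η : ℝ} {B : Finset (Fin n)} {C : Fin n × Fin n → Set ℝ}

theorem integral_sum_sq_interference_sub_le (hne : ∀ q, expMeasure 1 (C q) ≠ 0)
    (hC : ∀ q ∈ B ×ˢ B, C q = admissible D d q) :
    Integrable (fun x : Fin n × Fin n → ℝ =>
        ∑ i ∈ B, (interference (Function.curry x) B i - (B.card - 1) * condMean d) ^ 2)
        (Measure.pi fun q => ProbabilityTheory.cond (expMeasure 1) (C q)) ∧
      ∫ x : Fin n × Fin n → ℝ,
        ∑ i ∈ B, (interference (Function.curry x) B i - (B.card - 1) * condMean d) ^ 2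
        ∂(Measure.pi fun q => ProbabilityTheory.cond (expMeasure 1) (C q)) ≤
      B.card * (B.card * d ^ 2) := by
  have hprob := fun q => cond_isProbabilityMeasure (hne q)
  set μ : Fin n × Fin n → Measure ℝ :=
    fun q => ProbabilityTheory.cond (expMeasure 1) (C q) with hμ
  have hμq : ∀ i ∈ B, ∀ j ∈ B.erase i,
      μ (j, i) = ProbabilityTheory.cond (expMeasure 1) (Set.Iic d) := by
    intro i hi j hj
    simp only [hμ]
    rw [hC (j, i) (Finset.mk_mem_product (Finset.mem_of_mem_erase hj) hi)]
    simp [admissible, Finset.ne_of_mem_erase hj]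
  have hLp : ∀ q, MemLp (fun t : ℝ => t) 2 (μ q) := fun q =>
    memLp_cond memLp_two_expMeasure_one _ (hne q)
  have hI2 : ∀ i, MemLp (fun x : Fin n × Fin n → ℝ =>
      interference (Function.curry x) B i) 2 (Measure.pi μ) := fun i =>
    memLp_sum_eval (μ := μ) (s := B.erase i) (e := fun j => (j, i)) (f := fun t => t)
      fun j _ => hLp _
  have hImean : ∀ i ∈ B, ∫ x : Fin n × Fin n → ℝ, interference (Function.curry x) B i
      ∂Measure.pi μ = (B.card - 1) * condMean d := by
    intro i hi
    have h := integral_sum_eval (μ := μ) (s := B.erase i) (e := fun j => (j, i))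
      (f := fun t => t) fun j _ => hLp _
    refine h.trans ?_
    rw [Finset.sum_congr rfl fun j hj => by rw [hμq i hi j hj], Finset.sum_const,
      Finset.card_erase_of_mem hi, nsmul_eq_mul,
      Nat.cast_sub (Finset.card_pos.mpr ⟨i, hi⟩), Nat.cast_one]
    rfl
  have hIvar : ∀ i ∈ B, Var[fun x : Fin n × Fin n → ℝ =>
      interference (Function.curry x) B i; Measure.pi μ] ≤ B.card * d ^ 2 := by
    intro i hi
    have h := variance_sum_eval (μ := μ) (s := B.erase i) (e := fun j => (j, i))
      (f := fun t => t) (fun j _ j' _ h => (Prod.mk.inj h).1) measurable_id fun j _ => hLp _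
    refine h.trans_le ?_
    calc ∑ j ∈ B.erase i, Var[fun t => t; μ (j, i)] ≤ ∑ j ∈ B.erase i, d ^ 2 := by
          refine Finset.sum_le_sum fun j hj => ?_
          refine (variance_le_sq_of_bounded (a := 0) (b := d) ?_
            measurable_id.aemeasurable).trans (by nlinarith [sq_nonneg d])
          rw [hμq i hi j hj]
          exact ae_cond_Iic_mem_Icc d
      _ ≤ B.card * d ^ 2 := by
          rw [Finset.sum_const, nsmul_eq_mul]
          gcongr
          exact Finset.erase_subset _ _
  have hint : ∀ i ∈ B, Integrable (fun x : Fin n × Fin n → ℝ =>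
      (interference (Function.curry x) B i - (B.card - 1) * condMean d) ^ 2)
      (Measure.pi μ) := fun i _ => ((hI2 i).sub (memLp_const _)).integrable_sq
  refine ⟨integrable_finsetSum _ hint, ?_⟩
  rw [integral_finsetSum _ hint]
  calc _ ≤ ∑ i ∈ B, B.card * d ^ 2 := by
        refine Finset.sum_le_sum fun i hi => ?_
        have h := hIvar i hi
        rw [variance_eq_integral (hI2 i).1.aemeasurable, hImean i hi] at h
        exact h
    _ = B.card * (B.card * d ^ 2) := by rw [Finset.sum_const, nsmul_eq_mul]

theorem measureReal_sum_log_sub_le (hc : 0 < c) (hη : 0 < η) (hB : 0 < B.card)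
    (hne : ∀ q, expMeasure 1 (C q) ≠ 0) (hC : ∀ q ∈ B ×ˢ B, C q = admissible D d q) :
    (Measure.pi fun q => ProbabilityTheory.cond (expMeasure 1) (C q)).real
        {x | B.card * η ≤ |∑ i ∈ B, Real.log (1 + x (i, i) / c) - B.card * meanRate c D|} ≤
      Var[fun t => Real.log (1 + t / c);
        ProbabilityTheory.cond (expMeasure 1) (Set.Ioi D)] / (B.card * η ^ 2) := by
  have hprob := fun q => cond_isProbabilityMeasure (hne q)
  set μ : Fin n × Fin n → Measure ℝ :=
    fun q => ProbabilityTheory.cond (expMeasure 1) (C q) with hμ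
  have hB' : (0 : ℝ) < B.card := Nat.cast_pos.mpr hB
  have hμq : ∀ i ∈ B, μ (i, i) = ProbabilityTheory.cond (expMeasure 1) (Set.Ioi D) := by
    intro i hi
    simp only [hμ]
    rw [hC (i, i) (Finset.mk_mem_product hi hi)]
    simp [admissible]
  have hLp : ∀ q, MemLp (fun t : ℝ => Real.log (1 + t / c)) 2 (μ q) := fun q =>
    memLp_cond (memLp_log_one_add_div hc) _ (hne q)
  have h2 := memLp_sum_eval (μ := μ) (s := B) (e := fun i => (i, i)) fun i _ => hLp (i, i)
  have hmean := integral_sum_eval (μ := μ) (s := B) (e := fun i => (i, i))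
    fun i _ => hLp (i, i)
  have hvar := variance_sum_eval (μ := μ) (s := B) (e := fun i => (i, i))
    (fun i _ j _ h => (Prod.mk.inj h).1) (by fun_prop) fun i _ => hLp (i, i)
  rw [Finset.sum_congr rfl fun i hi => by rw [hμq i hi], Finset.sum_const, nsmul_eq_mul] at hmean
  rw [Finset.sum_congr rfl fun i hi => by rw [hμq i hi], Finset.sum_const, nsmul_eq_mul] at hvar
  have hpos : 0 < B.card * η := by positivity
  have h := meas_ge_le_variance_div_sq h2 hpos
  rw [hmean, hvar] at h
  have hr := ENNReal.toReal_mono ENNReal.ofReal_ne_top h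
  rw [ENNReal.toReal_ofReal (div_nonneg (mul_nonneg hB'.le (variance_nonneg _ _))
    (sq_nonneg _))] at hr
  refine hr.trans_eq ?_
  field_simp

theorem measureReal_deviation_le (hρ : 0 < ρ) (hc : 0 < c) (hη : 0 < η)
    (hB : 0 < B.card) (hne : ∀ q, expMeasure 1 (C q) ≠ 0)
    (hC : ∀ q ∈ B ×ˢ B, C q = admissible D d q) :
    (Measure.pi fun q => ProbabilityTheory.cond (expMeasure 1) (C q)).real
        {x | B.card * η ≤ deviation ρ c D d B x} ≤
      4 * ρ ^ 2 / η ^ 2 * (B.card * d ^ 2) +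
        4 * Var[fun t => Real.log (1 + t / c);
          ProbabilityTheory.cond (expMeasure 1) (Set.Ioi D)] / η ^ 2 * (B.card : ℝ)⁻¹ := by
  have hprob := fun q => cond_isProbabilityMeasure (hne q)
  have hB' : (0 : ℝ) < B.card := Nat.cast_pos.mpr hB
  obtain ⟨hint, hle⟩ := integral_sum_sq_interference_sub_le (D := D) (d := d) hne hC
  have hV := measureReal_sum_log_sub_le hc (half_pos hη) hB hne hC
  set Q := Measure.pi fun q => ProbabilityTheory.cond (expMeasure 1) (C q)
  set W : (Fin n × Fin n → ℝ) → ℝ := fun x =>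
    ∑ i ∈ B, (interference (Function.curry x) B i - (B.card - 1) * condMean d) ^ 2 with hW
  have hM := mul_meas_ge_le_integral_of_nonneg (μ := Q) (f := W)
    (Eventually.of_forall fun x => Finset.sum_nonneg fun i _ => sq_nonneg _) hint
    (B.card * (η / (2 * ρ)) ^ 2)
  have hsub : {x | B.card * η ≤ deviation ρ c D d B x} ⊆
      {x | B.card * (η / (2 * ρ)) ^ 2 ≤ W x} ∪
      {x | B.card * (η / 2) ≤
        |∑ i ∈ B, Real.log (1 + x (i, i) / c) - B.card * meanRate c D|} := by
    intro x hx
    by_contra hcon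
    simp only [Set.mem_union, Set.mem_ofPred_eq, not_or, not_le] at hcon hx
    obtain ⟨h1, h2⟩ := hcon
    rw [deviation] at hx
    set Y := ∑ i ∈ B, |interference (Function.curry x) B i - (B.card - 1) * condMean d| with hY
    have hcs : Y ^ 2 ≤ B.card * W x := by
      have := sq_sum_le_card_mul_sum_sq (s := B)
        (f := fun i => |interference (Function.curry x) B i - (B.card - 1) * condMean d|)
      simpa only [sq_abs] using this
    have h3 : Y ^ 2 < (B.card * (η / (2 * ρ))) ^ 2 := by
      refine hcs.trans_lt ?_
      rw [mul_pow, sq (B.card : ℝ), mul_assoc]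
      exact mul_lt_mul_of_pos_left h1 hB'
    have h4 : Y < B.card * (η / (2 * ρ)) := lt_of_pow_lt_pow_left₀ 2 (by positivity) h3
    have h5 : ρ * Y < B.card * (η / 2) := by
      calc ρ * Y < ρ * (B.card * (η / (2 * ρ))) := mul_lt_mul_of_pos_left h4 hρ
        _ = B.card * (η / 2) := by field_simp
    linarith
  refine (measureReal_mono hsub (measure_ne_top _ _)).trans
    ((measureReal_union_le _ _).trans (add_le_add ?_ (hV.trans_eq ?_)))
  · have hpos : 0 < B.card * (η / (2 * ρ)) ^ 2 := by positivity
    rw [← le_div_iff₀' hpos] at hM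
    refine hM.trans ((div_le_div_of_nonneg_right hle hpos.le).trans_eq ?_)
    field_simp
    ring
  · field_simp
    ring

end Chebyshev

section Selection

variable {sel : ∀ n : ℕ, Finset (Fin n) → SimpleGraph (Fin n) → Finset (Fin n)} {n : ℕ}
  {D d : ℝ}

theorem mem_phaseOne {x : Fin n × Fin n → ℝ} {i : Fin n} :
    i ∈ phaseOne (Function.curry x) D ↔ D < x (i, i) := by
  rw [phaseOne, Finset.mem_filter]
  simp [Function.curry]

theorem mem_box_square_iff {x : Fin n × Fin n → ℝ} {S : Finset (Fin n)} :
    x ∈ box D d (S ×ˢ S) ↔ S ⊆ phaseOne (Function.curry x) D ∧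
      (compatGraph (Function.curry x) (phaseOne (Function.curry x) D) d).IsClique
        (S : Set (Fin n)) := by
  simp only [box, Set.mem_ofPred_eq, Finset.mem_product, Prod.forall, admissible]
  constructor
  · intro h
    have hsub : S ⊆ phaseOne (Function.curry x) D := by
      intro i hi
      have := h i i ⟨hi, hi⟩
      exact mem_phaseOne.mpr (by simpa using this)
    refine ⟨hsub, fun i hi j hj hij => ⟨hij, hsub hi, hsub hj, ?_, ?_⟩⟩
    · simpa [hij] using h i j ⟨hi, hj⟩
    · simpa [hij.symm] using h j i ⟨hj, hi⟩
  · rintro ⟨hsub, hcl⟩ i j ⟨hi, hj⟩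
    by_cases hij : i = j
    · subst hij
      simpa using mem_phaseOne.mp (hsub hi)
    · simpa [hij] using (hcl hi hj hij).2.2.2.1

theorem mem_box_dtblas (hsel : IsPhaseTwoRule sel) (x : Fin n × Fin n → ℝ) :
    x ∈ box D d (dtblas sel (Function.curry x) D d ×ˢ dtblas sel (Function.curry x) D d) :=
  mem_box_square_iff.mpr ⟨(hsel _ _ _).1, (hsel _ _ _).2.1⟩

theorem card_le_card_dtblas (hsel : IsPhaseTwoRule sel) {x : Fin n × Fin n → ℝ}
    {S : Finset (Fin n)} (hS : x ∈ box D d (S ×ˢ S)) :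
    S.card ≤ (dtblas sel (Function.curry x) D d).card :=
  (hsel _ _ _).2.2 S (mem_box_square_iff.mp hS).1 (mem_box_square_iff.mp hS).2

theorem card_dtblas_mono (hsel : IsPhaseTwoRule sel) {d' : ℝ} (hdd : d ≤ d')
    (x : Fin n × Fin n → ℝ) :
    (dtblas sel (Function.curry x) D d).card ≤ (dtblas sel (Function.curry x) D d').card := by
  refine card_le_card_dtblas hsel fun q hq => ?_
  have h := mem_box_dtblas (D := D) (d := d) hsel x q hq
  unfold admissible at h ⊢
  split_ifs with hq' <;> simp only [hq', if_true, if_false] at h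
  exacts [h, h.trans hdd]

open Classical in
/-- The coefficients that are admissible. -/
noncomputable def pattern (D d : ℝ) (x : Fin n × Fin n → ℝ) : Finset (Fin n × Fin n) :=
  Finset.univ.filter fun q => x q ∈ admissible D d q

theorem dtblas_eq_of_pattern_eq {x y : Fin n × Fin n → ℝ} (h : pattern D d x = pattern D d y) :
    dtblas sel (Function.curry x) D d = dtblas sel (Function.curry y) D d := by
  have h1 : ∀ q, x q ∈ admissible D d q ↔ y q ∈ admissible D d q := fun q => by
    simpa [pattern] using Finset.ext_iff.mp h q
  have hV : phaseOne (Function.curry x) D = phaseOne (Function.curry y) D := by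
    ext i
    simpa [mem_phaseOne, admissible] using h1 (i, i)
  have hG : compatGraph (Function.curry x) (phaseOne (Function.curry x) D) d =
      compatGraph (Function.curry y) (phaseOne (Function.curry y) D) d := by
    ext i j
    simp only [compatGraph, hV]
    refine and_congr_right fun hij => and_congr_right fun _ => and_congr_right fun _ => ?_
    have h2 := h1 (i, j)
    have h3 := h1 (j, i)
    simp only [admissible, hij, hij.symm, if_false, Set.mem_Iic] at h2 h3
    exact and_congr h2 h3
  rw [dtblas, dtblas, hG, hV]

open Classical in
theorem pattern_preimage_singleton (T : Finset (Fin n × Fin n)) :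
    pattern D d ⁻¹' {T} = Set.univ.pi fun q =>
      if q ∈ T then admissible D d q else (admissible D d q)ᶜ := by
  ext x
  simp only [Set.mem_preimage, Set.mem_singleton_iff, Set.mem_pi, Set.mem_univ, true_imp_iff,
    pattern, Finset.ext_iff, Finset.mem_filter, Finset.mem_univ, true_and]
  refine forall_congr' fun q => ?_
  by_cases hq : q ∈ T <;> simp [hq]

/-- Given the pattern of admissible coefficients, the coefficients are independent and those
between active links are conditioned on being admissible; an event on the active links that is
uniformly unlikely under all these laws is unlikely. -/
theorem chanLaw_real_dtblas_le (hsel : IsPhaseTwoRule sel) (K : Finset (Fin n) → Prop)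
    (Bad : Finset (Fin n) → Set (Fin n × Fin n → ℝ)) {τ : ℝ} (hτ : 0 ≤ τ)
    (h : ∀ (C : Fin n × Fin n → Set ℝ) (B : Finset (Fin n)), K B →
      (∀ q, expMeasure 1 (C q) ≠ 0) → (∀ q ∈ B ×ˢ B, C q = admissible D d q) →
      (Measure.pi fun q => ProbabilityTheory.cond (expMeasure 1) (C q)).real (Bad B) ≤ τ) :
    (chanLaw n).real {x | K (dtblas sel (Function.curry x) D d) ∧
      x ∈ Bad (dtblas sel (Function.curry x) D d)} ≤ τ := by
  classical
  set F := {x : Fin n × Fin n → ℝ | K (dtblas sel (Function.curry x) D d) ∧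
      x ∈ Bad (dtblas sel (Function.curry x) D d)} with hF
  have hcell : ∀ T : Finset (Fin n × Fin n), (chanLaw n).real (pattern D d ⁻¹' {T} ∩ F) ≤
      τ * (chanLaw n).real (pattern D d ⁻¹' {T}) := by
    intro T
    rcases (pattern D d ⁻¹' {T} ∩ F).eq_empty_or_nonempty with he | ⟨x₀, hx₀, hK, -⟩
    · rw [he, measureReal_empty]
      positivity
    set B := dtblas sel (Function.curry x₀) D d with hB
    have hsub : pattern D d ⁻¹' {T} ∩ F ⊆ pattern D d ⁻¹' {T} ∩ Bad B := by
      rintro x ⟨hx, -, hbad⟩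
      refine ⟨hx, ?_⟩
      rwa [hB, ← dtblas_eq_of_pattern_eq (hx.trans hx₀.symm)]
    refine (measureReal_mono hsub).trans ?_
    rw [pattern_preimage_singleton]
    set C : Fin n × Fin n → Set ℝ :=
      fun q => if q ∈ T then admissible D d q else (admissible D d q)ᶜ with hCdef
    have hCm : ∀ q, MeasurableSet (C q) := by
      intro q
      simp only [hCdef]
      split_ifs
      exacts [measurableSet_admissible D d q, (measurableSet_admissible D d q).compl]
    by_cases hne : ∀ q, expMeasure 1 (C q) ≠ 0
    · have hCB : ∀ q ∈ B ×ˢ B, C q = admissible D d q := by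
        intro q hq
        have hmem : q ∈ T := by
          have h1 : pattern D d x₀ = T := hx₀
          rw [← h1, pattern, Finset.mem_filter]
          exact ⟨Finset.mem_univ q, mem_box_dtblas hsel x₀ q hq⟩
        simp [hCdef, hmem]
      have hb := h C B hK hne hCB
      rw [← cond_pi_eq hCm hne] at hb
      have hcond := cond_mul_eq_inter (MeasurableSet.univ_pi hCm) (Bad B) (chanLaw n)
      have hcond' := congrArg ENNReal.toReal hcond
      rw [ENNReal.toReal_mul] at hcond'
      calc (chanLaw n).real (Set.univ.pi C ∩ Bad B)
          = (ProbabilityTheory.cond (chanLaw n) (Set.univ.pi C)).real (Bad B) *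
              (chanLaw n).real (Set.univ.pi C) := hcond'.symm
        _ ≤ τ * (chanLaw n).real (Set.univ.pi C) :=
            mul_le_mul_of_nonneg_right hb measureReal_nonneg
    · push Not at hne
      obtain ⟨q, hq⟩ := hne
      have hz : (chanLaw n).real (Set.univ.pi C) = 0 := by
        rw [measureReal_eq_zero_iff, chanLaw, Measure.pi_pi]
        exact Finset.prod_eq_zero (Finset.mem_univ q) hq
      refine (measureReal_mono Set.inter_subset_left).trans ?_
      rw [hz, mul_zero]
  have hmeas : ∀ T : Finset (Fin n × Fin n), MeasurableSet (pattern D d ⁻¹' {T}) := by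
    intro T
    rw [pattern_preimage_singleton]
    refine MeasurableSet.univ_pi fun q => ?_
    split_ifs
    exacts [measurableSet_admissible D d q, (measurableSet_admissible D d q).compl]
  have hcover : F ⊆ ⋃ T ∈ (Finset.univ : Finset (Finset (Fin n × Fin n))),
      pattern D d ⁻¹' {T} ∩ F := by
    intro x hx
    simp only [Set.mem_iUnion]
    exact ⟨pattern D d x, Finset.mem_univ _, rfl, hx⟩
  calc (chanLaw n).real F
      ≤ (chanLaw n).real (⋃ T ∈ (Finset.univ : Finset (Finset (Fin n × Fin n))),
          pattern D d ⁻¹' {T} ∩ F) := measureReal_mono hcover (measure_ne_top _ _)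
    _ ≤ ∑ T, (chanLaw n).real (pattern D d ⁻¹' {T} ∩ F) := measureReal_biUnion_finset_le _ _
    _ ≤ ∑ T, τ * (chanLaw n).real (pattern D d ⁻¹' {T}) := Finset.sum_le_sum fun T _ => hcell T
    _ = τ * ∑ T, (chanLaw n).real (pattern D d ⁻¹' {T}) := by rw [Finset.mul_sum]
    _ ≤ τ := by
        rw [sum_measureReal_preimage_singleton _ fun T _ => hmeas T]
        exact mul_le_of_le_one_right hτ measureReal_le_one

end Selection

section Concentration

variable {sel : ∀ n : ℕ, Finset (Fin n) → SimpleGraph (Fin n) → Finset (Fin n)}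
  {D a : ℝ} {d : ℕ → ℝ}

theorem tendsto_chanLaw_card_dtblas (hsel : IsPhaseTwoRule sel) (hD : 0 ≤ D) (ha : 0 < a)
    (hd : Tendsto (fun n => d n / scale n) atTop (𝓝 a)) {η : ℝ} (hη : 0 < η) (hη1 : η < 1) :
    Tendsto (fun n => (chanLaw n).real {x | η ≤
      |(dtblas sel (Function.curry x) D (d n)).card * scale n - 1|}) atTop (𝓝 0) := by
  have h1 := tendsto_chanLaw_exists_large_clique (κ := 1 + η) (by linarith) D ha hd
  have h2 := tendsto_chanLaw_no_clique (κ := 1 - η / 2) (by linarith) (by linarith) hD ha hd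
  have h3 := h1.add h2
  rw [add_zero] at h3
  refine squeeze_zero' (Eventually.of_forall fun _ => measureReal_nonneg) ?_ h3
  filter_upwards [eventually_scale_pos] with n hs
  refine (measureReal_mono ?_ (measure_ne_top _ _)).trans (measureReal_union_le _ _)
  intro x hx
  rcases le_abs.mp (show η ≤ |_| from hx) with h | h
  · exact Or.inl ⟨_, by rw [div_le_iff₀ hs]; linarith, mem_box_dtblas hsel x⟩
  · refine Or.inr ?_
    rintro ⟨S, hS, hxS⟩
    have hc : (S.card : ℝ) ≤ (dtblas sel (Function.curry x) D (d n)).card := by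
      exact_mod_cast card_le_card_dtblas hsel hxS
    rw [div_le_iff₀ hs] at hS
    nlinarith

theorem eventually_abs_sub_one_mul_condMean_le {b : ℝ} (hb : 0 < b)
    (hd : Tendsto (fun n => d n / scale n) atTop (𝓝 (2 * b))) {η : ℝ} (hη : 0 < η)
    (hη1 : η < 1) :
    ∀ᶠ n in atTop, ∀ k : ℕ, |k * scale n - 1| < η →
      |((k : ℝ) - 1) * condMean (d n) - b| ≤ η * (b + 3) := by
  have hb2 : 0 < 2 * b := by linarith
  have h0 := tendsto_zero_of_div_scale hd
  have hpos := eventually_pos_of_div_scale hb2 hd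
  have hdiv := tendsto_condMean_div h0 hpos
  have hμs : Tendsto (fun n => condMean (d n) / scale n) atTop (𝓝 b) := by
    have h := hdiv.mul hd
    rw [show 1 / 2 * (2 * b) = b by ring] at h
    refine h.congr' ?_
    filter_upwards [hpos] with n hn
    exact div_mul_div_cancel₀ hn.ne'
  have hμ : Tendsto (fun n => condMean (d n)) atTop (𝓝 0) := by
    have h := hdiv.mul h0
    rw [mul_zero] at h
    refine h.congr' ?_
    filter_upwards [hpos] with n hn
    exact div_mul_cancel₀ _ hn.ne'
  filter_upwards [eventually_scale_pos, hμ.eventually (gt_mem_nhds hη),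
    hμs.eventually (Metric.ball_mem_nhds b hη)] with n hs h1 h2 k hk
  set μ := condMean (d n)
  have hμ0 : 0 ≤ μ := condMean_nonneg _
  rw [Real.dist_eq] at h2
  have e : ((k : ℝ) - 1) * μ - b =
      (k * scale n - 1) * (μ / scale n) + (μ / scale n - b) - μ := by
    field_simp
    ring
  have h3 : 0 ≤ μ / scale n := by positivity
  have h4 : μ / scale n ≤ b + 1 := by linarith [(abs_lt.mp h2).2]
  have h5 : |(k * scale n - 1) * (μ / scale n)| ≤ η * (b + 1) := by
    rw [abs_mul, abs_of_nonneg h3]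
    exact mul_le_mul hk.le h4 h3 hη.le
  rw [e, abs_le]
  obtain ⟨h6, h7⟩ := abs_le.mp h5
  obtain ⟨h8, h9⟩ := abs_lt.mp h2
  constructor <;> linarith

theorem ae_chanLaw_nonneg (n : ℕ) : ∀ᵐ x ∂chanLaw n, ∀ q, 0 ≤ x q := by
  rw [ae_all_iff]
  intro q
  exact (measurePreserving_eval (fun _ : Fin n × Fin n => expMeasure 1) q).quasiMeasurePreserving.ae
    ae_expMeasure_one_nonneg

theorem tendsto_chanLaw_deviation (hsel : IsPhaseTwoRule sel) {ρ c η : ℝ} (hρ : 0 < ρ)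
    (hc : 0 < c) (hη : 0 < η) (hη1 : η ≤ 1 / 2)
    (hd : Tendsto (fun n => d n / scale n) atTop (𝓝 a)) :
    Tendsto (fun n => (chanLaw n).real {x |
      |(dtblas sel (Function.curry x) D (d n)).card * scale n - 1| < η ∧
      (dtblas sel (Function.curry x) D (d n)).card * η ≤
        deviation ρ c D (d n) (dtblas sel (Function.curry x) D (d n)) x}) atTop (𝓝 0) := by
  set v := Var[fun t => Real.log (1 + t / c);
    ProbabilityTheory.cond (expMeasure 1) (Set.Ioi D)]
  have hv : 0 ≤ v := variance_nonneg _ _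
  have hτ : Tendsto (fun n => 4 * ρ ^ 2 / η ^ 2 * (2 * (d n / scale n) * d n) +
      4 * v / η ^ 2 * (2 * scale n)) atTop (𝓝 0) := by
    have h := ((((hd.const_mul 2).mul (tendsto_zero_of_div_scale hd)).const_mul
      (4 * ρ ^ 2 / η ^ 2))).add ((tendsto_scale.const_mul 2).const_mul (4 * v / η ^ 2))
    simpa using h
  refine squeeze_zero' (Eventually.of_forall fun _ => measureReal_nonneg) ?_ hτ
  filter_upwards [eventually_scale_pos] with n hs
  have hdd : 0 ≤ 2 * (d n / scale n) * d n := by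
    have : 2 * (d n / scale n) * d n = 2 * d n ^ 2 / scale n := by ring
    rw [this]
    positivity
  refine chanLaw_real_dtblas_le hsel (fun B => |B.card * scale n - 1| < η)
    (fun B => {x | B.card * η ≤ deviation ρ c D (d n) B x}) (by positivity) ?_
  intro C B hK hne hCB
  obtain ⟨hK1, hK2⟩ := abs_lt.mp hK
  have hBpos : (0 : ℝ) < B.card := by
    by_contra! hcon
    nlinarith
  refine (measureReal_deviation_le hρ hc hη (by exact_mod_cast hBpos) hne hCB).trans ?_
  have h1 : (B.card : ℝ) * d n ^ 2 ≤ 2 * (d n / scale n) * d n := by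
    have : (B.card : ℝ) ≤ 2 / scale n := by
      rw [le_div_iff₀ hs]; linarith
    calc (B.card : ℝ) * d n ^ 2 ≤ 2 / scale n * d n ^ 2 := by gcongr
      _ = _ := by ring
  have h2 : (B.card : ℝ)⁻¹ ≤ 2 * scale n := by
    rw [inv_le_iff_one_le_mul₀ hBpos]
    linarith
  gcongr

theorem tendsto_chanLaw_throughput (hsel : IsPhaseTwoRule sel) {ρ β : ℝ} (hρ : 0 < ρ)
    (hβ : 0 < β) (hD : 0 ≤ D) (hd : Tendsto (fun n => d n / scale n) atTop (𝓝 (2 * β)))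
    {ε : ℝ} (hε : 0 < ε) :
    Tendsto (fun n => (chanLaw n).real {x | ε ≤ |scale n *
      throughput ρ (Function.curry x) (dtblas sel (Function.curry x) D (d n)) -
        meanRate (1 / ρ + β) D|}) atTop (𝓝 0) := by
  set L := meanRate (1 / ρ + β) D
  set M := 2 * (1 + ρ * (β + 3)) + |L| with hM
  have hMpos : 0 < M := by positivity
  obtain ⟨η, hη, hη1, hηM⟩ : ∃ η : ℝ, 0 < η ∧ η ≤ 1 / 2 ∧ η * M < ε := by
    refine ⟨min (1 / 2) (ε / (2 * M)), by positivity, min_le_left _ _, ?_⟩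
    calc min (1 / 2) (ε / (2 * M)) * M ≤ ε / (2 * M) * M := by gcongr; exact min_le_right _ _
      _ = ε / 2 := by field_simp
      _ < ε := half_lt_self hε
  have hη2 : η < 1 := by linarith
  have h1 := tendsto_chanLaw_card_dtblas hsel hD (by linarith) hd hη hη2
  have h2 := tendsto_chanLaw_deviation (D := D) hsel hρ (c := 1 / ρ + β) (by positivity) hη hη1 hd
  have h3 := h1.add h2
  rw [add_zero] at h3
  refine squeeze_zero' (Eventually.of_forall fun _ => measureReal_nonneg) ?_ h3
  filter_upwards [eventually_scale_pos,
    eventually_abs_sub_one_mul_condMean_le hβ hd hη hη2] with n hs hmean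
  refine le_trans ?_ (measureReal_union_le _ _)
  refine ENNReal.toReal_mono (measure_ne_top _ _) (measure_mono_ae ?_)
  filter_upwards [ae_chanLaw_nonneg n] with x hx hbad
  by_contra hcon
  set B := dtblas sel (Function.curry x) D (d n) with hB
  obtain ⟨hc1, hc2⟩ := not_or.mp hcon
  have hk : |(B.card : ℝ) * scale n - 1| < η := not_le.mp hc1
  have hdev : deviation ρ (1 / ρ + β) D (d n) B x < B.card * η := by
    by_contra! hcon
    exact hc2 ⟨hk, hcon⟩
  have hT := abs_throughput_sub_le (D := D) (d := d n) hρ hβ.le B hx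
  have hm := hmean B.card hk
  have hT2 : |throughput ρ (Function.curry x) B - B.card * L| ≤
      B.card * (η * (1 + ρ * (β + 3))) := by
    refine hT.trans ?_
    have : (B.card : ℝ) * (ρ * |(B.card - 1) * condMean (d n) - β|) ≤
        B.card * (ρ * (η * (β + 3))) := by gcongr
    linarith
  have hks : (B.card : ℝ) * scale n ≤ 2 := by linarith [(abs_lt.mp hk).2]
  have hfinal : |scale n * throughput ρ (Function.curry x) B - L| ≤ η * M := by
    have e : scale n * throughput ρ (Function.curry x) B - L =
        scale n * (throughput ρ (Function.curry x) B - B.card * L) +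
          (B.card * scale n - 1) * L := by ring
    rw [e]
    refine (abs_add_le _ _).trans ?_
    rw [abs_mul, abs_mul, abs_of_pos hs]
    have h4 : scale n * |throughput ρ (Function.curry x) B - B.card * L| ≤
        2 * (η * (1 + ρ * (β + 3))) := by
      calc _ ≤ scale n * (B.card * (η * (1 + ρ * (β + 3)))) := by gcongr
        _ = (B.card * scale n) * (η * (1 + ρ * (β + 3))) := by ring
        _ ≤ _ := by gcongr
    have h5 : |(B.card : ℝ) * scale n - 1| * |L| ≤ η * |L| := by gcongr
    rw [hM]
    linarith
  have hbad' : ε ≤ |scale n * throughput ρ (Function.curry x) B - L| := hbad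
  linarith

end Concentration

section Transfer

variable {Ω : ℕ → Type*} [∀ n, MeasurableSpace (Ω n)] {P : ∀ n, Measure (Ω n)}
  [∀ n, IsProbabilityMeasure (P n)] {g : ∀ n, Ω n → Fin n → Fin n → ℝ}

theorem measure_le_chanLaw
    (hlaw : ∀ (n : ℕ) (i j : Fin n), HasLaw (fun ω => g n ω i j) (expMeasure 1) (P n))
    (hindep : ∀ n : ℕ, iIndepFun (fun (q : Fin n × Fin n) ω => g n ω q.1 q.2) (P n)) (n : ℕ)
    (p : (Fin n → Fin n → ℝ) → Prop) :
    P n {ω | p (g n ω)} ≤ ENNReal.ofReal ((chanLaw n).real {x | p (Function.curry x)}) := by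
  have hae : ∀ q : Fin n × Fin n, AEMeasurable (fun ω => g n ω q.1 q.2) (P n) :=
    fun q => (hlaw n q.1 q.2).aemeasurable
  have hmap := (iIndepFun_iff_map_fun_eq_pi_map hae).mp (hindep n)
  simp only [(hlaw n _ _).map_eq] at hmap
  rw [ofReal_measureReal, chanLaw, ← hmap]
  exact Measure.le_map_apply (aemeasurable_pi_lambda _ hae) {x | p (Function.curry x)}

theorem limAAS_of_tendsto
    (hlaw : ∀ (n : ℕ) (i j : Fin n), HasLaw (fun ω => g n ω i j) (expMeasure 1) (P n))
    (hindep : ∀ n : ℕ, iIndepFun (fun (q : Fin n × Fin n) ω => g n ω q.1 q.2) (P n))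
    {Y : ∀ n, (Fin n → Fin n → ℝ) → ℝ} {c : ℝ}
    (h : ∀ ε : ℝ, 0 < ε → Tendsto (fun n =>
      (chanLaw n).real {x | ε ≤ |Y n (Function.curry x) - c|}) atTop (𝓝 0)) :
    LimAAS P (fun n ω => Y n (g n ω)) c := by
  intro ε hε
  have h1 : Tendsto (fun n => 1 - ENNReal.ofReal
      ((chanLaw n).real {x | ε ≤ |Y n (Function.curry x) - c|})) atTop (𝓝 1) := by
    have h2 := ENNReal.Tendsto.sub (tendsto_const_nhds (x := (1 : ENNReal)))
      (ENNReal.tendsto_ofReal (h ε hε)) (Or.inl ENNReal.one_ne_top)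
    simpa using h2
  refine tendsto_of_tendsto_of_tendsto_of_le_of_le h1 tendsto_const_nhds (fun n => ?_)
    (fun n => prob_le_one)
  refine tsub_le_iff_right.mpr ?_
  have hb := measure_le_chanLaw hlaw hindep n fun G => ε ≤ |Y n G - c|
  calc (1 : ENNReal) = P n Set.univ := measure_univ.symm
    _ ≤ P n ({ω | |Y n (g n ω) - c| < ε} ∪ {ω | ε ≤ |Y n (g n ω) - c|}) :=
        measure_mono fun ω _ => lt_or_ge (|Y n (g n ω) - c|) ε
    _ ≤ _ := (measure_union_le _ _).trans (add_le_add_right hb _)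

theorem eventually_exists_of_limAAS
    (hlaw : ∀ (n : ℕ) (i j : Fin n), HasLaw (fun ω => g n ω i j) (expMeasure 1) (P n))
    (hindep : ∀ n : ℕ, iIndepFun (fun (q : Fin n × Fin n) ω => g n ω q.1 q.2) (P n))
    {X : ∀ n, Ω n → ℝ} {c : ℝ} (hX : LimAAS P X c) {ε : ℝ} (hε : 0 < ε)
    {p : ∀ n, (Fin n → Fin n → ℝ) → Prop}
    (hp : Tendsto (fun n => (chanLaw n).real {x | p n (Function.curry x)}) atTop (𝓝 0)) :
    ∀ᶠ n in atTop, ∃ ω, |X n ω - c| < ε ∧ ¬ p n (g n ω) := by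
  have hp' := ENNReal.tendsto_ofReal hp
  rw [ENNReal.ofReal_zero] at hp'
  have hhalf : (2⁻¹ : ENNReal) < 1 := ENNReal.inv_lt_one.mpr ENNReal.one_lt_two
  filter_upwards [(hX ε hε).eventually (lt_mem_nhds hhalf),
    hp'.eventually (gt_mem_nhds (show (0 : ENNReal) < 2⁻¹ by simp))] with n h1 h2
  by_contra! hcon
  have hsub : {ω | |X n ω - c| < ε} ⊆ {ω | p n (g n ω)} := fun ω hω => hcon ω hω
  exact absurd ((measure_mono hsub).trans ((measure_le_chanLaw hlaw hindep n (p n)).trans h2.le))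
    (not_le.mpr h1)

theorem tendsto_div_scale_of_limAAS
    (hlaw : ∀ (n : ℕ) (i j : Fin n), HasLaw (fun ω => g n ω i j) (expMeasure 1) (P n))
    (hindep : ∀ n : ℕ, iIndepFun (fun (q : Fin n × Fin n) ω => g n ω q.1 q.2) (P n))
    {sel : ∀ n : ℕ, Finset (Fin n) → SimpleGraph (Fin n) → Finset (Fin n)}
    (hsel : IsPhaseTwoRule sel) {D β : ℝ} (hD : 0 ≤ D) (hβ : 0 < β) {δ : ℕ → ℝ}
    (hδ : LimAAS P (fun n ω => (((dtblas sel (g n ω) D (δ n)).card : ℝ) - 1) *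
      condMean (δ n)) β) :
    Tendsto (fun n => δ n / scale n) atTop (𝓝 (2 * β)) := by
  have key : ∀ b : ℝ, 0 < b → ∀ t : ℝ, 0 < t → ∀ᶠ n in atTop, 0 < scale n ∧ ∃ ω,
      |(((dtblas sel (g n ω) D (δ n)).card : ℝ) - 1) * condMean (δ n) - β| < t ∧
      |(((dtblas sel (g n ω) D (2 * b * scale n)).card : ℝ) - 1) *
        condMean (2 * b * scale n) - b| < t := by
    intro b hb t ht
    have hd : Tendsto (fun n => 2 * b * scale n / scale n) atTop (𝓝 (2 * b)) := by
      refine tendsto_const_nhds.congr' ?_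
      filter_upwards [eventually_scale_pos] with n hs
      exact (mul_div_cancel_right₀ _ hs.ne').symm
    set η := min (1 / 2) (t / (2 * (b + 3))) with hη
    have hη0 : 0 < η := by positivity
    have hη1 : η < 1 := (min_le_left _ _).trans_lt (by norm_num)
    have hηt : η * (b + 3) < t := by
      calc η * (b + 3) ≤ t / (2 * (b + 3)) * (b + 3) := by gcongr; exact min_le_right _ _
        _ = t / 2 := by field_simp
        _ < t := half_lt_self ht
    have hcard := tendsto_chanLaw_card_dtblas hsel hD (by positivity) hd hη0 hη1
    filter_upwards [eventually_scale_pos,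
      eventually_exists_of_limAAS hlaw hindep hδ ht
        (p := fun n G => η ≤ |(dtblas sel G D (2 * b * scale n)).card * scale n - 1|) hcard,
      eventually_abs_sub_one_mul_condMean_le hb hd hη0 hη1] with n hs ⟨ω, h1, h2⟩ h3
    exact ⟨hs, ω, h1, (h3 _ (not_le.mp h2)).trans_lt hηt⟩
  have hmono : ∀ n ω {d d' : ℝ}, d ≤ d' → ((dtblas sel (g n ω) D d).card : ℝ) ≤
      (dtblas sel (g n ω) D d').card := fun n ω d d' h => by
    exact_mod_cast card_dtblas_mono (D := D) hsel h fun q => g n ω q.1 q.2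
  rw [tendsto_order]
  constructor
  · intro a ha
    set b := max (a / 2) (β / 2) with hb
    have hb0 : 0 < b := lt_max_of_lt_right (by linarith)
    have hbβ : b < β := max_lt (by linarith) (by linarith)
    have hab : a ≤ 2 * b := by linarith [le_max_left (a / 2) (β / 2)]
    filter_upwards [key b hb0 ((β - b) / 2) (by linarith)] with n ⟨hs, ω, h1, h2⟩
    rw [lt_div_iff₀ hs]
    by_contra! hcon
    have hle : δ n ≤ 2 * b * scale n := hcon.trans (by gcongr)
    have h3 := hmono n ω hle
    have h4 := condMean_mono hle
    have h5 := condMean_nonneg (δ n)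
    have h6 := (abs_lt.mp h1).1
    have h7 := (abs_lt.mp h2).2
    have h8 : 0 < ((dtblas sel (g n ω) D (δ n)).card : ℝ) - 1 :=
      pos_of_mul_pos_left (by linarith) h5
    have h9 := mul_le_mul (sub_le_sub_right h3 1) h4 h5 (by linarith)
    linarith
  · intro a ha
    have hb0 : 0 < a / 2 := by linarith
    filter_upwards [key (a / 2) hb0 ((a / 2 - β) / 2) (by linarith)] with n ⟨hs, ω, h1, h2⟩
    rw [div_lt_iff₀ hs]
    by_contra! hcon
    have hle : 2 * (a / 2) * scale n ≤ δ n := by linarith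
    have h3 := hmono n ω hle
    have h4 := condMean_mono hle
    have h5 := condMean_nonneg (2 * (a / 2) * scale n)
    have h6 := (abs_lt.mp h1).2
    have h7 := (abs_lt.mp h2).1
    have h8 : 0 < ((dtblas sel (g n ω) D (2 * (a / 2) * scale n)).card : ℝ) - 1 :=
      pos_of_mul_pos_left (by linarith) h5
    have h9 := mul_le_mul (sub_le_sub_right h3 1) h4 h5 (by linarith)
    linarith

end Transfer

theorem tendsto_div_scale_of_isEquivalent {β : ℝ} (hβ : 0 < β) {δ : ℕ → ℝ}
    (hδ : Asymptotics.IsEquivalent atTop δ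
      (fun n : ℕ => 2 * β * Real.log (Real.log n) / Real.log n)) :
    Tendsto (fun n => δ n / scale n) atTop (𝓝 (2 * β)) := by
  have e : (fun n : ℕ => 2 * β * Real.log (Real.log n) / Real.log n) =
      fun n => 2 * β * scale n := by
    ext n; rw [scale, mul_div_assoc]
  rw [e] at hδ
  have hne : ∀ᶠ n in atTop, 2 * β * scale n ≠ 0 := by
    filter_upwards [eventually_scale_pos] with n hs
    positivity
  have h := ((Asymptotics.isEquivalent_iff_tendsto_one hne).mp hδ).const_mul (2 * β)
  rw [mul_one] at h
  refine h.congr' ?_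
  filter_upwards [eventually_scale_pos] with n hs
  rw [Pi.div_apply]
  field_simp

end NoiseLimited

theorem lemma6
    -- transmit SNR, interference parameter and required rate
    (ρ β lam : ℝ) (hρ : 0 < ρ) (hβ : 0 < β) (hlam : 0 < lam)
    -- the channel coefficients of the `n`-link network are i.i.d. exponential with mean one
    {Ω : ℕ → Type*} [∀ n, MeasurableSpace (Ω n)]
    (P : ∀ n, MeasureTheory.Measure (Ω n)) [∀ n, MeasureTheory.IsProbabilityMeasure (P n)]
    (g : ∀ n, Ω n → Fin n → Fin n → ℝ)
    (hlaw : ∀ (n : ℕ) (i j : Fin n),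
      ProbabilityTheory.HasLaw (fun ω => g n ω i j) (ProbabilityTheory.expMeasure 1) (P n))
    (hindep : ∀ n : ℕ,
      ProbabilityTheory.iIndepFun (fun (q : Fin n × Fin n) ω => g n ω q.1 q.2) (P n))
    -- the rule by which DTBLAS picks a largest complete subgraph
    (sel : ∀ n : ℕ, Finset (Fin n) → SimpleGraph (Fin n) → Finset (Fin n))
    (hsel : NoiseLimited.IsPhaseTwoRule sel)
    -- `δ` is chosen so that `(k₂ - 1) E(X | X ≤ δ) = β` holds asymptotically, or through the
    -- explicit asymptotic solution of that equation
    (δ : ℕ → ℝ)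
    (hδ : NoiseLimited.LimAAS P
          (fun n ω =>
            (((NoiseLimited.dtblas sel (g n ω)
              (NoiseLimited.directThreshold lam ρ β) (δ n)).card : ℝ) - 1) *
                NoiseLimited.condMean (δ n)) β ∨
        Asymptotics.IsEquivalent Filter.atTop δ
          (fun n : ℕ => 2 * β * Real.log (Real.log n) / Real.log n)) :
    ∃ L : ℝ,
      Real.log (1 + NoiseLimited.directThreshold lam ρ β / (1 / ρ + β)) ≤ L ∧
      L ≤ Real.log (1 + (NoiseLimited.directThreshold lam ρ β + 1) / (1 / ρ + β)) ∧
      NoiseLimited.LimAAS P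
        (fun n ω =>
          Real.log (Real.log n) / Real.log n *
            NoiseLimited.throughput ρ (g n ω)
              (NoiseLimited.dtblas sel (g n ω)
                (NoiseLimited.directThreshold lam ρ β) (δ n))) L := by
  have hD : 0 ≤ NoiseLimited.directThreshold lam ρ β := by
    have : 0 ≤ Real.exp lam - 1 := by linarith [Real.add_one_le_exp lam]
    unfold NoiseLimited.directThreshold
    positivity
  have hc : 0 < 1 / ρ + β := by positivity
  have hd : Tendsto (fun n => δ n / NoiseLimited.scale n) atTop (𝓝 (2 * β)) := by
    rcases hδ with hδ | hδ
    · exact NoiseLimited.tendsto_div_scale_of_limAAS hlaw hindep hsel hD hβ hδ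
    · exact NoiseLimited.tendsto_div_scale_of_isEquivalent hβ hδ
  exact ⟨NoiseLimited.meanRate (1 / ρ + β) (NoiseLimited.directThreshold lam ρ β),
    NoiseLimited.log_le_meanRate hc hD, NoiseLimited.meanRate_le_log hc hD,
    NoiseLimited.limAAS_of_tendsto hlaw hindep
      (Y := fun n G => NoiseLimited.scale n * NoiseLimited.throughput ρ G
        (NoiseLimited.dtblas sel G (NoiseLimited.directThreshold lam ρ β) (δ n)))
      fun _ hε => NoiseLimited.tendsto_chanLaw_throughput hsel hρ hβ hD hd hε⟩
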